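/- A probability distribution on $\mathbb R$ is infinitely divisible if, for every integer $n\ge 1$, it is the distribution of a sum of $n$ independent, identically distributed real random variables. For a function $\varphi:\mathbb R\to\mathbb C$, $\log\varphi$ denotes the continuous function $\psi:\mathbb R\to\mathbb C$ with $\psi(0)=0$ and $e^{\psi}=\varphi$ (there is at most one). For a bounded nondecreasing function $G:\mathbb R\to\mathbb R$, $dG$ denotes its Lebesgue--Stieltjes measure, so that $dG((a,b])=G(b+)-G(a+)$. (1) A function $\varphi:\mathbb R\to\mathbb C$ is the characteristic function of an infinitely divisible distribution if and only if $\log\varphi$ exists and there are a real number $\gamma$ and a bounded nondecreasing function $G:\mathbb R\to\mathbb R$ such that $$\log\varphi(t)=i\gamma t+\int_{-\infty}^{\infty}\Bigl(e^{itu}-1-\frac{itu}{1+u^2}\Bigr)\frac{1+u^2}{u^2}\,dG(u)\qquad(t\in\mathbb R),\tag{$*$}$$ where the integrand at $u=0$ is $-t^2/2$. (2) The representation is unique: if $(\gamma,G)$ and $(\gamma',G')$ both satisfy $(*)$ for the same $\varphi$, then $\gamma=\gamma'$ and $G-G'$ is constant on the set of common continuity points of $G$ and $G'$. In particular, if $\varphi$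 is the characteristic function of an infinitely divisible distribution, there is exactly one pair $(\gamma,G)$ satisfying $(*)$ in which $G$ is moreover right-continuous with $G(-\infty)=0$. (3) $G$ is recovered from $\varphi$ by an inversion formula. Suppose $(*)$ holds and put $$\Delta(t)=\int_{t-1}^{t+1}\log\varphi(\alpha)\,d\alpha-2\log\varphi(t),\qquad K(u)=-2\int_0^u\Bigl(1-\frac{\sin v}{v}\Bigr)\frac{1+v^2}{v^2}\,dG(v),$$ where the integrand of $K$ at $v=0$ is $\tfrac16$, the integral is oriented, and a point mass of $dG$ at either endpoint $0$ or $u$ is counted with weight $\tfrac12$. Then for every $u\in\mathbb R$ $$K(u)=\lim_{T\to\infty}\frac1{2\pi}\int_{-T}^{T}\frac{1-e^{-itu}}{it}\,\Delta(t)\,dt .$$ Moreover $K$ determines $G$: if two bounded nondecreasing functions $G$ and $H$ give rise to the same function $K$, then $G-H$ is constant on the set of common continuity points of $G$ and $H$. -/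

import Mathlib

open MeasureTheory Filter Topology

noncomputable section

namespace LevyKhintchine

/-- A probability measure on `ℝ` is infinitely divisible if, for every `n ≥ 1`, it is the law of
the sum of `n` independent random variables with a common law `ν` (realised as the coordinates on
the product space `(ℝⁿ, ν ⊗ ⋯ ⊗ ν)`). -/
def IsInfinitelyDivisible (μ : Measure ℝ) : Prop :=
  IsProbabilityMeasure μ ∧ ∀ n : ℕ, 1 ≤ n → ∃ ν : Measure ℝ, IsProbabilityMeasure ν ∧
    μ = (Measure.pi (fun _ : Fin n => ν)).map (fun x => ∑ i, x i)

/-- `φ` is the characteristic function of an infinitely divisible distribution. -/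
def IsInfinitelyDivisibleCharFun (φ : ℝ → ℂ) : Prop :=
  ∃ μ : Measure ℝ, IsInfinitelyDivisible μ ∧ ∀ t, φ t = charFun μ t

/-- `ψ = log φ`: the continuous branch of the logarithm of `φ` that vanishes at `0`
(there is at most one such `ψ`). -/
structure IsContinuousLog (φ ψ : ℝ → ℂ) : Prop where
  continuous : Continuous ψ
  map_zero : ψ 0 = 0
  exp_eq : ∀ t, Complex.exp (ψ t) = φ t

/-- The integrand `(e^{itu} - 1 - itu/(1+u²)) (1+u²)/u²`, taken to be `-t²/2` at `u = 0`. -/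
def kernel (t u : ℝ) : ℂ :=
  if u = 0 then -((t : ℂ) ^ 2 / 2)
  else (Complex.exp (Complex.I * t * u) - 1 - Complex.I * t * u / (1 + (u : ℂ) ^ 2)) *
    ((1 + (u : ℂ) ^ 2) / (u : ℂ) ^ 2)

/-- `iγt + ∫ (e^{itu} - 1 - itu/(1+u²)) (1+u²)/u² dG(u)`, where `dG` is the Lebesgue–Stieltjes
measure of the nondecreasing function `G`, with `dG((a, b]) = G(b+) - G(a+)`. -/
def exponent (γ : ℝ) {G : ℝ → ℝ} (hG : Monotone G) (t : ℝ) : ℂ :=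
  Complex.I * γ * t + ∫ u, kernel t u ∂hG.stieltjesFunction.measure

/-- `G` is bounded and nondecreasing, and `log φ` is given by the canonical formula with
`γ` and `G`. -/
structure IsRepresentation (φ : ℝ → ℂ) (γ : ℝ) (G : ℝ → ℝ) : Prop where
  monotone : Monotone G
  bounded : ∃ C : ℝ, ∀ u, |G u| ≤ C
  log_eq : ∃ ψ : ℝ → ℂ, IsContinuousLog φ ψ ∧ ∀ t, ψ t = exponent γ monotone t

/-- Two functions differ by an additive constant, except possibly at discontinuities. -/
def EqUpToConst (G H : ℝ → ℝ) : Prop :=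
  ∃ c : ℝ, ∀ u, ContinuousAt G u → ContinuousAt H u → G u = H u + c

/-- `Δ(t) = ∫_{t-1}^{t+1} ψ(α) dα - 2 ψ(t)`, for `ψ = log φ`. -/
def secondDiff (ψ : ℝ → ℂ) (t : ℝ) : ℂ :=
  (∫ α in (t - 1)..(t + 1), ψ α) - 2 * ψ t

/-- The density `-2 (1 - sin v / v) (1+v²)/v²`, taken to be its limit `-1/3` at `v = 0`. -/
def weight (v : ℝ) : ℝ :=
  if v = 0 then -(1 / 3) else -2 * (1 - Real.sin v / v) * ((1 + v ^ 2) / v ^ 2)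

/-- `K(u) = ∫_0^u weight(v) dG(v)`, where `(sign v - sign (v - u)) / 2` is the oriented indicator
function of the interval from `0` to `u`, which gives each endpoint the weight `1/2`. So this is
the usual oriented integral when `0` and `u` are continuity points of `G`. -/
def primitive {G : ℝ → ℝ} (hG : Monotone G) (u : ℝ) : ℝ :=
  ∫ v, ((Real.sign v - Real.sign (v - u)) / 2) * weight v ∂hG.stieltjesFunction.measure

end LevyKhintchine

end

namespace LevyKhintchine

/-! ### The kernel and the weight -/

/-! Everything rests on one averaging identity, `secondDiff_kernel`: applying `secondDiff` in `t` to
`kernel t u` yields `e^{itu} * weight u`, while the drift `iγt` is annihilated. The weight is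
continuous, strictly negative, bounded and bounded away from `0`. Hence minus the second difference
of an exponent is the characteristic function of the finite measure `-weight dM`
(`charFun_weightedMeasure`).

Uniqueness follows at once: the logarithm is unique because `exp` is a covering map, characteristic
functions determine finite measures, and the weight can be divided out; then `γ` is read off at `t =
1`. Inverting the same characteristic function with the Dirichlet integral gives the formula for
`K`. Its limit involves `sign`, with `sign 0 = 0`, which is where the half weights at the endpoints
come from.

Every pair `(γ, M)` occurs: away from `0` it is a shifted compound Poisson law, a limit removes the
cut-off, and the atom at `0` contributes a Gaussian factor
(`exists_charFun_eq_exp_measureExponent`). Dividing `γ` and `M` by `n` produces the `n`-th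
convolution root.

Conversely, an infinitely divisible `φ` has no zeros, so `ψ = log φ` exists, and `n (e^{ψ/n} - 1) →
ψ`. Each term is an exponent, because `e^{ψ/n}` is the characteristic function of an `n`-th root.
`exists_measureExponent_eq_of_tendsto` shows that the limit is again an exponent: the second
differences converge, so the weighted measures converge weakly, and dividing by the weight recovers
both `M` and `γ`. -/

lemma exp_sub_one_sub_eq (z : ℂ) :
    Complex.exp z - 1 - z = z ^ 2 * ∫ s in (0 : ℝ)..1, (1 - s : ℂ) * Complex.exp (s * z) := by
  rcases eq_or_ne z 0 with rfl | hz
  · simp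
  have h : ∀ s ∈ Set.uIcc (0 : ℝ) 1, HasDerivAt
      (fun s : ℝ => (1 - s : ℂ) * Complex.exp (s * z) / z + Complex.exp (s * z) / z ^ 2)
      ((1 - s : ℂ) * Complex.exp (s * z)) s := by
    intro s _
    have h1 : HasDerivAt (fun s : ℝ => (s : ℂ)) 1 s := Complex.ofRealCLM.hasDerivAt
    have h2 : HasDerivAt (fun s : ℝ => Complex.exp (s * z)) (Complex.exp (s * z) * (1 * z)) s :=
      (h1.mul_const z).cexp
    convert! (((h1.const_sub 1).mul h2).div_const z).add (h2.div_const (z ^ 2)) using 1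
    field_simp
    ring
  rw [intervalIntegral.integral_eq_sub_of_hasDerivAt h
    (Continuous.intervalIntegrable (by fun_prop) _ _)]
  simp only [Complex.ofReal_one, sub_self, zero_mul, one_mul, zero_div, zero_add,
    Complex.ofReal_zero, sub_zero, Complex.exp_zero]
  field_simp
  ring

/-- The Taylor remainder in integral form removes the singularity at `u = 0`, so joint continuity of
the kernel reduces to that of a parametric integral. -/
lemma kernel_eq (t u : ℝ) :
    kernel t u = -((1 + (u : ℂ) ^ 2) * (t : ℂ) ^ 2 *
      ∫ s in (0 : ℝ)..1, (1 - s : ℂ) * Complex.exp (s * (Complex.I * t * u)))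
        + Complex.I * t * u := by
  rcases eq_or_ne u 0 with rfl | hu
  · have : (∫ s in (0 : ℝ)..1, (1 - s : ℂ)) = 1 / 2 := by
      have h : (∫ s in (0 : ℝ)..1, (1 - s : ℝ)) = 1 / 2 := by
        rw [intervalIntegral.integral_sub (by simp) (by simp)]; norm_num
      have h2 := congrArg (fun x : ℝ => (x : ℂ)) h
      simp only [← intervalIntegral.integral_ofReal] at h2
      simpa using h2
    simp [kernel, this]
    ring
  · have h1 : (u : ℂ) ≠ 0 := by exact_mod_cast hu
    have h2 : (1 + (u : ℂ) ^ 2) ≠ 0 := by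
      have : (1 + u ^ 2 : ℝ) ≠ 0 := by positivity
      exact_mod_cast this
    have h := exp_sub_one_sub_eq (Complex.I * t * u)
    set J := ∫ s in (0 : ℝ)..1, (1 - s : ℂ) * Complex.exp (s * (Complex.I * t * u))
    have h' : Complex.exp (Complex.I * t * u) = 1 + Complex.I * t * u
        + (Complex.I * t * u) ^ 2 * J := by linear_combination h
    rw [kernel, if_neg hu, h']
    field_simp
    rw [Complex.I_sq]
    ring

lemma continuous_kernel : Continuous (fun p : ℝ × ℝ => kernel p.1 p.2) := by
  simp only [kernel_eq]
  have : Continuous (fun p : ℝ × ℝ =>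
      ∫ s in (0 : ℝ)..1, (1 - s : ℂ) * Complex.exp (s * (Complex.I * p.1 * p.2))) := by
    apply intervalIntegral.continuous_parametric_intervalIntegral_of_continuous'
    unfold Function.uncurry
    fun_prop
  fun_prop

@[fun_prop]
lemma continuous_kernel_left (u : ℝ) : Continuous (fun t => kernel t u) :=
  continuous_kernel.comp (by fun_prop : Continuous fun t : ℝ => (t, u))

@[fun_prop]
lemma continuous_kernel_right (t : ℝ) : Continuous (kernel t) :=
  continuous_kernel.comp (by fun_prop : Continuous fun u : ℝ => (t, u))

@[simp]
lemma kernel_zero_left (u : ℝ) : kernel 0 u = 0 := by simp [kernel]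

/-- Uniformity in `u` makes the kernel integrable against any finite measure. The remainder form
serves for `|u| ≤ 1`, the defining formula for `|u| > 1`. -/
lemma norm_kernel_le (t u : ℝ) : ‖kernel t u‖ ≤ 4 + |t| + 2 * t ^ 2 := by
  rcases le_or_gt |u| 1 with hu | hu
  · have hJ : ‖∫ s in (0 : ℝ)..1, (1 - s : ℂ) * Complex.exp (s * (Complex.I * t * u))‖
        ≤ 1 := by
      refine (intervalIntegral.norm_integral_le_of_norm_le_const (C := 1) ?_).trans (by simp)
      intro s hs
      rw [Set.uIoc_of_le zero_le_one] at hs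
      have h1 : ‖(1 - s : ℂ)‖ ≤ 1 := by
        rw [show (1 - s : ℂ) = ((1 - s : ℝ) : ℂ) by push_cast; ring, Complex.norm_real,
          Real.norm_eq_abs, abs_le]
        constructor <;> linarith [hs.1, hs.2]
      have h2 : ‖Complex.exp (s * (Complex.I * t * u))‖ = 1 := by
        rw [show (s * (Complex.I * t * u) : ℂ) = ((s * t * u : ℝ) : ℂ) * Complex.I by
          push_cast; ring, Complex.norm_exp_ofReal_mul_I]
      rw [norm_mul, h2, mul_one]
      exact h1
    have hu2 : u ^ 2 ≤ 1 := by rw [← sq_abs]; nlinarith [abs_nonneg u]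
    rw [kernel_eq]
    refine (norm_add_le _ _).trans ?_
    rw [norm_neg, norm_mul, norm_mul, norm_mul, norm_mul, Complex.norm_I, norm_pow,
      Complex.norm_real, Complex.norm_real, Real.norm_eq_abs, Real.norm_eq_abs, sq_abs]
    have h3 : ‖(1 + (u : ℂ) ^ 2)‖ ≤ 2 := by
      rw [show (1 + (u : ℂ) ^ 2) = ((1 + u ^ 2 : ℝ) : ℂ) by push_cast; ring, Complex.norm_real,
        Real.norm_eq_abs, abs_of_nonneg (by positivity)]
      linarith
    set n := ‖(1 + (u : ℂ) ^ 2)‖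
    set j := ‖∫ s in (0 : ℝ)..1, (1 - s : ℂ) * Complex.exp (s * (Complex.I * t * u))‖
    have h4 : n * t ^ 2 * j ≤ 2 * t ^ 2 * 1 := by gcongr
    have h5 : 1 * |t| * |u| ≤ 1 * |t| * 1 := by gcongr
    linarith
  · have hu0 : u ≠ 0 := by rintro rfl; simp at hu; linarith
    have hu2 : 1 ≤ u ^ 2 := by rw [← sq_abs]; nlinarith [abs_nonneg u]
    rw [kernel, if_neg hu0, norm_mul]
    have h1 : ‖Complex.exp (Complex.I * t * u)‖ = 1 := by
      rw [show (Complex.I * t * u : ℂ) = ((t * u : ℝ) : ℂ) * Complex.I by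
          push_cast; ring, Complex.norm_exp_ofReal_mul_I]
    have h2 : ‖Complex.I * t * u / (1 + (u : ℂ) ^ 2)‖ ≤ |t| / 2 := by
      rw [show (1 + (u : ℂ) ^ 2) = ((1 + u ^ 2 : ℝ) : ℂ) by push_cast; ring]
      rw [norm_div, norm_mul, norm_mul, Complex.norm_I, Complex.norm_real, Complex.norm_real,
        Complex.norm_real, Real.norm_eq_abs, Real.norm_eq_abs, Real.norm_eq_abs,
        abs_of_nonneg (show 0 ≤ 1 + u ^ 2 by positivity), div_le_div_iff₀ (by positivity)
        (by norm_num), ← sq_abs u]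
      nlinarith [mul_nonneg (abs_nonneg t) (sq_nonneg (|u| - 1))]
    have h3 : ‖(1 + (u : ℂ) ^ 2) / (u : ℂ) ^ 2‖ ≤ 2 := by
      rw [show (1 + (u : ℂ) ^ 2) / (u : ℂ) ^ 2 = (((1 + u ^ 2) / u ^ 2 : ℝ) : ℂ) by
        push_cast; ring, Complex.norm_real, Real.norm_eq_abs, abs_of_nonneg (by positivity),
        div_le_iff₀ (by positivity)]
      linarith
    have h4 : ‖Complex.exp (Complex.I * t * u) - 1 - Complex.I * t * u / (1 + (u : ℂ) ^ 2)‖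
        ≤ 2 + |t| / 2 := by
      refine (norm_sub_le _ _).trans (add_le_add ((norm_sub_le _ _).trans ?_) h2)
      rw [h1, norm_one]; norm_num
    calc _ ≤ (2 + |t| / 2) * 2 := by gcongr
      _ ≤ _ := by nlinarith [sq_nonneg t]

lemma integral_exp_I_mul (t : ℝ) {u : ℝ} (hu : u ≠ 0) :
    ∫ α in (t - 1)..(t + 1), Complex.exp (Complex.I * α * u)
      = Complex.exp (Complex.I * t * u) * (2 * (Real.sin u / u : ℝ)) := by
  have hu' : (u : ℂ) ≠ 0 := by exact_mod_cast hu
  have h := integral_exp_mul_complex (a := t - 1) (b := t + 1) (c := Complex.I * u)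
    (mul_ne_zero Complex.I_ne_zero hu')
  rw [show (fun α : ℝ => Complex.exp (Complex.I * α * u))
    = fun α : ℝ => Complex.exp (Complex.I * u * α) by ext; ring_nf, h]
  rw [show Complex.I * u * ((t + 1 : ℝ) : ℂ) = Complex.I * t * u + u * Complex.I by
    push_cast; ring, show Complex.I * u * ((t - 1 : ℝ) : ℂ) = Complex.I * t * u + (-u) * Complex.I by
    push_cast; ring, Complex.exp_add, Complex.exp_add]
  push_cast
  rw [Complex.sin]
  field_simp
  rw [Complex.I_sq]
  ring

/-- Over an interval of length `2` centred at `t`, terms constant or linear in `α` integrate to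
twice their value at `t` and cancel; the exponential is multiplied by `2 sin u / u`. At `u = 0` the
quadratic kernel leaves `-1/3`. -/
lemma secondDiff_kernel (t u : ℝ) :
    secondDiff (fun α => kernel α u) t = Complex.exp (Complex.I * t * u) * weight u := by
  rw [secondDiff]
  rcases eq_or_ne u 0 with rfl | hu
  · have h : (∫ α in (t - 1)..(t + 1), -(((α : ℂ)) ^ 2 / 2)) = -(t : ℂ) ^ 2 - 1 / 3 := by
      have h : (∫ α in (t - 1)..(t + 1), -(α ^ 2 / 2 : ℝ)) = -t ^ 2 - 1 / 3 := by
        rw [intervalIntegral.integral_neg, intervalIntegral.integral_div, integral_pow]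
        norm_num
        ring
      have h2 := congrArg (fun x : ℝ => (x : ℂ)) h
      simp only [← intervalIntegral.integral_ofReal] at h2
      push_cast at h2
      exact h2
    simp only [kernel, if_true, h, weight]
    push_cast
    simp
    ring
  · have hu' : (u : ℂ) ≠ 0 := by exact_mod_cast hu
    have h2 : (1 + (u : ℂ) ^ 2) ≠ 0 := by
      have : (1 + u ^ 2 : ℝ) ≠ 0 := by positivity
      exact_mod_cast this
    have hI : (∫ α in (t - 1)..(t + 1), Complex.I * (α : ℂ) * u / (1 + (u : ℂ) ^ 2))
        = 2 * (Complex.I * t * u / (1 + (u : ℂ) ^ 2)) := by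
      have h : (∫ α in (t - 1)..(t + 1), α) = 2 * t := by
        rw [integral_id]; ring
      have h3 := congrArg (fun x : ℝ => (x : ℂ)) h
      simp only [← intervalIntegral.integral_ofReal] at h3
      rw [intervalIntegral.integral_div, intervalIntegral.integral_mul_const,
        intervalIntegral.integral_const_mul, h3]
      push_cast
      ring
    simp only [kernel, if_neg hu, weight]
    rw [intervalIntegral.integral_mul_const, intervalIntegral.integral_sub
      (Continuous.intervalIntegrable (by fun_prop) _ _)
      (Continuous.intervalIntegrable (by fun_prop) _ _), intervalIntegral.integral_sub
      (Continuous.intervalIntegrable (by fun_prop) _ _)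
      (Continuous.intervalIntegrable (by fun_prop) _ _), hI, integral_exp_I_mul t hu,
      intervalIntegral.integral_const, Complex.real_smul]
    push_cast
    ring

lemma weight_eq_integral (u : ℝ) : (weight u : ℂ) = ∫ α in (-1 : ℝ)..1, kernel α u := by
  have h := secondDiff_kernel 0 u
  simp only [secondDiff, kernel_zero_left] at h
  simpa using h.symm

@[fun_prop]
lemma continuous_weight : Continuous weight := by
  have h : Continuous (fun u => ∫ α in (-1 : ℝ)..1, kernel α u) := by
    apply intervalIntegral.continuous_parametric_intervalIntegral_of_continuous'
    exact continuous_kernel.comp continuous_swap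
  have h2 : weight = fun u => (∫ α in (-1 : ℝ)..1, kernel α u).re := by
    ext u; rw [← weight_eq_integral, Complex.ofReal_re]
  rw [h2]
  exact Complex.continuous_re.comp h

lemma abs_weight_le (u : ℝ) : |weight u| ≤ 14 := by
  have h : ‖∫ α in (-1 : ℝ)..1, kernel α u‖ ≤ 7 * |(1 : ℝ) - (-1)| := by
    refine intervalIntegral.norm_integral_le_of_norm_le_const ?_
    intro s hs
    rw [Set.uIoc_of_le (by norm_num)] at hs
    have h1 : |s| ≤ 1 := abs_le.2 ⟨hs.1.le, hs.2⟩
    refine (norm_kernel_le s u).trans ?_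
    rw [← sq_abs]; nlinarith [abs_nonneg s]
  rw [← weight_eq_integral, Complex.norm_real, Real.norm_eq_abs] at h
  refine h.trans ?_
  norm_num

lemma weight_neg (u : ℝ) : weight u < 0 := by
  rcases eq_or_ne u 0 with rfl | hu
  · norm_num [weight]
  rw [weight, if_neg hu]
  have h1 : Real.sin u / u < 1 := by
    rcases lt_or_gt_of_ne hu with h | h
    · rw [div_lt_one_of_neg h]
      have := Real.sin_lt (neg_pos.2 h)
      rw [Real.sin_neg] at this
      linarith
    · rw [div_lt_one h]
      exact Real.sin_lt h
  have h2 : 0 < (1 + u ^ 2) / u ^ 2 := by positivity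
  nlinarith [mul_pos (sub_pos.2 h1) h2]

/-- Makes `1 / weight` bounded, so that weak limits of weighted measures can be divided by the
weight. Compactness handles `|u| ≤ 2`; beyond that `sin u / u ≤ 1/2`. -/
lemma exists_weight_le : ∃ c > 0, ∀ u, weight u ≤ -c := by
  obtain ⟨x, -, hx⟩ := (isCompact_Icc (a := (-2 : ℝ)) (b := 2)).exists_isMaxOn
    ⟨0, by norm_num⟩ continuous_weight.continuousOn
  refine ⟨min (-weight x) 1, lt_min (neg_pos.2 (weight_neg x)) one_pos, fun u => ?_⟩
  rcases le_or_gt |u| 2 with hu | hu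
  · have := hx (abs_le.1 hu)
    simp only [Set.mem_ofPred_eq] at this
    linarith [min_le_left (-weight x) 1]
  · have hu0 : u ≠ 0 := by rintro rfl; simp at hu; linarith
    have h1 : Real.sin u / u ≤ 1 / 2 := by
      refine (le_abs_self _).trans ?_
      rw [abs_div, div_le_div_iff₀ (abs_pos.2 hu0) two_pos]
      linarith [Real.abs_sin_le_one u]
    have h2 : 1 ≤ (1 + u ^ 2) / u ^ 2 := by
      rw [le_div_iff₀ (by positivity)]; linarith
    rw [weight, if_neg hu0]
    have h3 : 1 / 2 ≤ (1 - Real.sin u / u) * ((1 + u ^ 2) / u ^ 2) := by nlinarith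
    linarith [min_le_right (-weight x) 1]

/-! ### The exponent of a finite measure -/

/-- The exponent `iγt + ∫ kernel t u dM(u)` of a finite measure `M`. -/
noncomputable def measureExponent (γ : ℝ) (M : Measure ℝ) (t : ℝ) : ℂ :=
  Complex.I * γ * t + ∫ u, kernel t u ∂M

/-- The measure `-weight(v) dM(v)`. -/
noncomputable def weightedMeasure (M : Measure ℝ) : Measure ℝ :=
  M.withDensity fun v => ENNReal.ofReal (-weight v)

lemma integrable_of_continuous_of_norm_le {E : Type*} [NormedAddCommGroup E]
    {M : Measure ℝ} [IsFiniteMeasure M] {f : ℝ → E} (hf : Continuous f) {C : ℝ}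
    (hC : ∀ x, ‖f x‖ ≤ C) : Integrable f M :=
  Integrable.of_bound hf.aestronglyMeasurable C (Eventually.of_forall hC)

section FiniteMeasure

variable {M N : Measure ℝ} [IsFiniteMeasure M] [IsFiniteMeasure N]

lemma integrable_kernel (t : ℝ) : Integrable (kernel t) M :=
  integrable_of_continuous_of_norm_le (by fun_prop) (norm_kernel_le t)

lemma integrable_weight : Integrable weight M :=
  integrable_of_continuous_of_norm_le (by fun_prop) abs_weight_le

lemma continuous_measureExponent (γ : ℝ) : Continuous (measureExponent γ M) := by
  unfold measureExponent
  refine Continuous.add (by fun_prop) ?_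
  rw [continuous_iff_continuousAt]
  intro t₀
  refine continuousAt_of_dominated
    (bound := fun _ => 4 + (|t₀| + 1) + 2 * (|t₀| + 1) ^ 2)
    (Eventually.of_forall fun t => (continuous_kernel_right t).aestronglyMeasurable) ?_
    (integrable_const _) (Eventually.of_forall fun u => (continuous_kernel_left u).continuousAt)
  filter_upwards [Metric.ball_mem_nhds t₀ one_pos] with t ht
  refine Eventually.of_forall fun u => (norm_kernel_le t u).trans ?_
  have h1 : |t| ≤ |t₀| + 1 := by
    have h2 : |t - t₀| < 1 := by simpa [Real.dist_eq] using ht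
    have := abs_sub_abs_le_abs_sub t t₀
    linarith
  rw [← sq_abs t]
  gcongr

lemma norm_exp_I_mul (t v : ℝ) : ‖Complex.exp (Complex.I * t * v)‖ = 1 := by
  rw [show (Complex.I * t * v : ℂ) = ((t * v : ℝ) : ℂ) * Complex.I by push_cast; ring,
    Complex.norm_exp_ofReal_mul_I]

lemma secondDiff_measureExponent (γ t : ℝ) :
    secondDiff (measureExponent γ M) t
      = ∫ v, Complex.exp (Complex.I * t * v) * weight v ∂M := by
  have hcont : Continuous fun α : ℝ => ∫ u, kernel α u ∂M := by
    have h := continuous_measureExponent (M := M) 0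
    have h0 : measureExponent 0 M = fun α : ℝ => ∫ u, kernel α u ∂M := by
      ext α; simp [measureExponent]
    rwa [h0] at h
  have hlin : ∫ α in (t - 1)..(t + 1), Complex.I * γ * (α : ℂ) = 2 * (Complex.I * γ * t) := by
    have h : (∫ α in (t - 1)..(t + 1), α) = 2 * t := by
      rw [integral_id]; ring
    have h3 := congrArg (fun x : ℝ => (x : ℂ)) h
    simp only [← intervalIntegral.integral_ofReal] at h3
    rw [intervalIntegral.integral_const_mul, h3]
    push_cast
    ring
  have hswap : ∫ α in (t - 1)..(t + 1), ∫ u, kernel α u ∂M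
      = ∫ u, (∫ α in (t - 1)..(t + 1), kernel α u) ∂M := by
    have : IsFiniteMeasure (volume.restrict (Set.uIoc (t - 1) (t + 1))) :=
      ⟨by simp [Set.uIoc]⟩
    apply intervalIntegral_integral_swap
    refine Integrable.of_bound (continuous_kernel.aestronglyMeasurable)
      (4 + (|t| + 1) + 2 * (|t| + 1) ^ 2) ?_
    have hae : ∀ᵐ α ∂(volume.restrict (Set.uIoc (t - 1) (t + 1))), |α| ≤ |t| + 1 := by
      refine ae_restrict_of_forall_mem measurableSet_uIoc fun α hα => ?_
      rw [Set.uIoc_of_le (by linarith)] at hα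
      rw [abs_le]
      constructor <;> linarith [hα.1, hα.2, neg_abs_le t, le_abs_self t]
    filter_upwards [Measure.quasiMeasurePreserving_fst.ae hae] with p hp
    refine (norm_kernel_le p.1 p.2).trans ?_
    rw [← sq_abs p.1]
    gcongr
  have hint : Integrable (fun u => ∫ α in (t - 1)..(t + 1), kernel α u) M := by
    have hk : (fun u => ∫ α in (t - 1)..(t + 1), kernel α u)
        = fun u : ℝ => Complex.exp (Complex.I * t * (u : ℝ)) * weight u + 2 * kernel t u := by
      ext u; rw [← secondDiff_kernel, secondDiff]; ring
    rw [hk]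
    refine Integrable.add ?_ ((integrable_kernel t).const_mul 2)
    refine integrable_of_continuous_of_norm_le (by fun_prop) (C := 14) fun u => ?_
    rw [norm_mul, norm_exp_I_mul, one_mul, Complex.norm_real]
    exact abs_weight_le u
  simp only [secondDiff, measureExponent]
  rw [intervalIntegral.integral_add (Continuous.intervalIntegrable (by fun_prop) _ _)
    (hcont.intervalIntegrable _ _), hlin, hswap]
  simp only [← secondDiff_kernel, secondDiff]
  rw [integral_sub hint ((integrable_kernel t).const_mul 2), integral_const_mul]
  ring

instance : IsFiniteMeasure (weightedMeasure M) :=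
  isFiniteMeasure_withDensity_ofReal integrable_weight.neg.2

lemma integral_weightedMeasure {E : Type*} [NormedAddCommGroup E] [NormedSpace ℝ E]
    (M : Measure ℝ) (f : ℝ → E) :
    ∫ v, f v ∂(weightedMeasure M) = ∫ v, (-weight v) • f v ∂M := by
  rw [weightedMeasure, integral_withDensity_eq_integral_toReal_smul (by fun_prop) (by simp)]
  congr with v
  rw [ENNReal.toReal_ofReal (by linarith [weight_neg v])]

lemma charFun_weightedMeasure (γ t : ℝ) :
    charFun (weightedMeasure M) t = -secondDiff (measureExponent γ M) t := by
  rw [secondDiff_measureExponent, charFun_apply_real, integral_weightedMeasure, ← integral_neg]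
  congr with v
  rw [Complex.real_smul, show (t * v * Complex.I : ℂ) = Complex.I * t * v by ring]
  push_cast
  ring

omit [IsFiniteMeasure M] [IsFiniteMeasure N] in
lemma weightedMeasure_withDensity_inv (M : Measure ℝ) :
    (weightedMeasure M).withDensity (fun v => (ENNReal.ofReal (-weight v))⁻¹) = M :=
  withDensity_inv_same (by fun_prop)
    (Eventually.of_forall fun v => by simpa using weight_neg v)
    (Eventually.of_forall fun v => by simp)

omit [IsFiniteMeasure M] [IsFiniteMeasure N] in
lemma weightedMeasure_injective (h : weightedMeasure M = weightedMeasure N) : M = N := by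
  rw [← weightedMeasure_withDensity_inv M, h, weightedMeasure_withDensity_inv]

lemma measureExponent_injective {γ γ' : ℝ}
    (h : measureExponent γ M = measureExponent γ' N) : γ = γ' ∧ M = N := by
  have hM : M = N := by
    apply weightedMeasure_injective
    apply Measure.ext_of_charFun
    ext t
    rw [charFun_weightedMeasure γ, charFun_weightedMeasure γ', h]
  subst hM
  refine ⟨?_, rfl⟩
  have h1 := congrFun h 1
  simp only [measureExponent, add_left_inj, Complex.ofReal_one, mul_one] at h1
  exact_mod_cast mul_left_cancel₀ Complex.I_ne_zero h1

end FiniteMeasure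

/-- Two lifts through the covering `exp` that agree at one point of the connected space `ℝ` agree
everywhere. -/
lemma IsContinuousLog.unique {φ ψ ψ' : ℝ → ℂ} (h : IsContinuousLog φ ψ)
    (h' : IsContinuousLog φ ψ') : ψ = ψ' := by
  refine Complex.isCoveringMap_exp.eq_of_comp_eq h.continuous h'.continuous ?_ 0
    (h.map_zero.trans h'.map_zero.symm)
  ext t
  simp [h.exp_eq, h'.exp_eq]

/-! ### Limits of characteristic functions -/

open BoundedContinuousFunction in
-- Lévy continuity without a given limit law: continuity of `g` at `0` forces tightness, Prokhorov
-- supplies a cluster point, and convergence along an ultrafilter identifies its characteristic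
-- function as `g`.
lemma exists_probabilityMeasure_of_tendsto_charFun (p : ℕ → ProbabilityMeasure ℝ) {g : ℝ → ℂ}
    (hg : ContinuousAt g 0)
    (h : ∀ t, Tendsto (fun n => charFun (p n : Measure ℝ) t) atTop (𝓝 (g t))) :
    ∃ q : ProbabilityMeasure ℝ, (∀ t, charFun (q : Measure ℝ) t = g t) ∧
      Tendsto p atTop (𝓝 q) := by
  have htight : IsTightMeasureSet (Set.range fun n => (p n : Measure ℝ)) :=
    isTightMeasureSet_of_tendsto_charFun hg h
  have hcomp : IsCompact (closure (Set.range p)) := by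
    apply isCompact_closure_of_isTightMeasureSet
    convert htight using 1
    ext x
    simp
  obtain ⟨q, -, hq⟩ := hcomp.exists_mapClusterPt (f := atTop) (u := p)
    (tendsto_principal.2 (Eventually.of_forall fun n => subset_closure (Set.mem_range_self n)))
  have hchar : ∀ t, charFun (q : Measure ℝ) t = g t := by
    intro t
    obtain ⟨U, hU, hlim⟩ := mapClusterPt_iff_ultrafilter.1 hq
    refine tendsto_nhds_unique ?_ ((h t).mono_left hU)
    rw [ProbabilityMeasure.tendsto_iff_forall_integral_rclike_tendsto ℂ] at hlim
    simp_rw [charFun_eq_integral_innerProbChar]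
    exact hlim (innerProbChar t)
  refine ⟨q, hchar, ProbabilityMeasure.tendsto_of_tendsto_charFun fun t => ?_⟩
  rw [hchar]
  exact h t

lemma exists_eq_smul_isProbabilityMeasure (w : Measure ℝ) [IsFiniteMeasure w] :
    ∃ p : ProbabilityMeasure ℝ, w = (w Set.univ).toNNReal • (p : Measure ℝ) := by
  rcases eq_or_ne w 0 with rfl | hw
  · exact ⟨⟨Measure.dirac 0, inferInstance⟩, by simp⟩
  · have : NeZero w := ⟨hw⟩
    refine ⟨⟨(w Set.univ)⁻¹ • w, isProbabilityMeasureSMul⟩, ?_⟩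
    ext s -
    simp only [ProbabilityMeasure.coe_mk, Measure.smul_apply, smul_eq_mul, ENNReal.smul_def,
      ENNReal.coe_toNNReal (measure_ne_top w _)]
    rw [← mul_assoc, ENNReal.mul_inv_cancel (by simpa using hw) (measure_ne_top w _), one_mul]

lemma integral_eq_mul_integral {w : Measure ℝ} {p : Measure ℝ}
    (h : w = (w Set.univ).toNNReal • p) (f : ℝ → ℂ) :
    ∫ x, f x ∂w = w.real Set.univ * ∫ x, f x ∂p := by
  conv_lhs => rw [h]
  rw [integral_smul_nnreal_measure]
  simp [Measure.real, NNReal.smul_def, ENNReal.toReal]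

open BoundedContinuousFunction in
-- Reduces to probability measures by normalising: the total masses are the values at `t = 0`, hence
-- converge to `g 0`.
lemma exists_measure_of_tendsto_charFun (w : ℕ → Measure ℝ) [∀ n, IsFiniteMeasure (w n)]
    {g : ℝ → ℂ} (hg : ContinuousAt g 0)
    (h : ∀ t, Tendsto (fun n => charFun (w n) t) atTop (𝓝 (g t))) :
    ∃ W : Measure ℝ, IsFiniteMeasure W ∧ (∀ t, charFun W t = g t) ∧
      ∀ f : ℝ →ᵇ ℂ, Tendsto (fun n => ∫ x, f x ∂(w n)) atTop (𝓝 (∫ x, f x ∂W)) := by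
  choose p hp using fun n => exists_eq_smul_isProbabilityMeasure (w n)
  have hint : ∀ n (f : ℝ → ℂ), ∫ x, f x ∂(w n)
      = (w n).real Set.univ * ∫ x, f x ∂(p n : Measure ℝ) := fun n f =>
    integral_eq_mul_integral (hp n) f
  have hchar : ∀ n t, charFun (w n) t = (w n).real Set.univ * charFun (p n : Measure ℝ) t := by
    intro n t
    simp only [charFun_apply]
    exact hint n _
  have h0 := h 0
  simp only [charFun_zero] at h0
  have hm : Tendsto (fun n => (w n).real Set.univ) atTop (𝓝 (g 0).re) := by
    exact (Complex.continuous_re.tendsto _).comp h0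
  set m := (g 0).re with hm_def
  have hm' : Tendsto (fun n => ((w n).real Set.univ : ℂ)) atTop (𝓝 (m : ℂ)) :=
    (Complex.continuous_ofReal.tendsto _).comp hm
  have hm0 : 0 ≤ m := ge_of_tendsto' hm fun n => measureReal_nonneg
  -- Normalisation breaks down when the limiting mass is `0`; then all bounded integrals tend to `0`
  -- and the limit is the zero measure.
  rcases hm0.eq_or_lt with hm1 | hm1
  · have hzero : ∀ f : ℝ → ℂ, ∀ C : ℝ, (∀ x, ‖f x‖ ≤ C) →
        Tendsto (fun n => ∫ x, f x ∂(w n)) atTop (𝓝 0) := by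
      intro f C hC
      refine squeeze_zero_norm (a := fun n => C * (w n).real Set.univ)
        (fun n => norm_integral_le_of_norm_le_const (Eventually.of_forall hC)) ?_
      simpa [← hm1] using hm.const_mul C
    refine ⟨0, inferInstance, fun t => ?_, fun f => ?_⟩
    · rw [charFun_zero_measure]
      refine tendsto_nhds_unique ?_ (h t)
      simp_rw [charFun_eq_integral_innerProbChar]
      exact hzero _ _ (innerProbChar t).norm_coe_le_norm
    · simpa using hzero f _ f.norm_coe_le_norm
  · have hmC : (m : ℂ) ≠ 0 := by exact_mod_cast hm1.ne'
    have hne : ∀ᶠ n in atTop, ((w n).real Set.univ : ℂ) ≠ 0 := hm'.eventually_ne hmC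
    obtain ⟨q, hq, hlim⟩ := exists_probabilityMeasure_of_tendsto_charFun p
      (g := fun t => g t / m) (hg.div_const _) fun t => by
        refine ((h t).div hm' hmC).congr' ?_
        filter_upwards [hne] with n hn
        simp only [Pi.div_apply]
        rw [hchar, mul_div_cancel_left₀ _ hn]
    have hWint : ∀ f : ℝ → ℂ, ∫ x, f x ∂(m.toNNReal • (q : Measure ℝ))
        = m * ∫ x, f x ∂(q : Measure ℝ) := by
      intro f
      rw [integral_smul_nnreal_measure, NNReal.smul_def, Real.coe_toNNReal _ hm0,
        Complex.real_smul]
    refine ⟨m.toNNReal • (q : Measure ℝ), inferInstance, fun t => ?_, fun f => ?_⟩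
    · have := hq t
      rw [charFun_apply] at this ⊢
      rw [hWint, this, mul_div_cancel₀ _ hmC]
    · simp_rw [hint, hWint]
      rw [ProbabilityMeasure.tendsto_iff_forall_integral_rclike_tendsto ℂ] at hlim
      exact hm'.mul (hlim f)

lemma exists_charFun_eq_exp_of_tendsto_exp {ψ : ℝ → ℂ} (hψ : Continuous ψ)
    (p : ℕ → Measure ℝ) (hp : ∀ n, IsProbabilityMeasure (p n))
    (h : ∀ t, Tendsto (fun n => charFun (p n) t) atTop (𝓝 (Complex.exp (ψ t)))) :
    ∃ μ : Measure ℝ, IsProbabilityMeasure μ ∧ ∀ t, charFun μ t = Complex.exp (ψ t) := by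
  obtain ⟨q, hq, -⟩ := exists_probabilityMeasure_of_tendsto_charFun (fun n => ⟨p n, hp n⟩)
    (g := fun t => Complex.exp (ψ t)) (by fun_prop) h
  exact ⟨q, inferInstance, hq⟩

lemma charFun_map_sum_pi_const (ν : Measure ℝ) [IsProbabilityMeasure ν] (n : ℕ) (t : ℝ) :
    charFun ((Measure.pi fun _ : Fin n => ν).map fun x => ∑ i, x i) t = charFun ν t ^ n := by
  rw [ProbabilityTheory.charFun_map_sum_pi_eq_prod]
  simp

/-- The `n`-fold convolution power of `p n` has characteristic function `(1 + z_n / n)^n` with `z_n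
→ ψ t`, which tends to `exp (ψ t)`. -/
lemma exists_charFun_eq_exp_of_tendsto_mul {ψ : ℝ → ℂ} (hψ : Continuous ψ)
    (p : ℕ → Measure ℝ) (hp : ∀ n, IsProbabilityMeasure (p n))
    (h : ∀ t, Tendsto (fun n : ℕ => n * (charFun (p n) t - 1)) atTop (𝓝 (ψ t))) :
    ∃ μ : Measure ℝ, IsProbabilityMeasure μ ∧ ∀ t, charFun μ t = Complex.exp (ψ t) := by
  refine exists_charFun_eq_exp_of_tendsto_exp hψ
    (fun n => (Measure.pi fun _ : Fin n => p n).map fun x => ∑ i, x i)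
    (fun n => Measure.isProbabilityMeasure_map (by fun_prop)) fun t => ?_
  simp_rw [charFun_map_sum_pi_const]
  simpa using Complex.tendsto_one_add_pow_exp_of_tendsto (h t)

/-! ### Existence of a distribution with a given exponent -/

/-- The compound Poisson law with jump measure `l`, as a limit of sums of `n` rare jumps. -/
lemma exists_charFun_eq_exp_charFun_sub (l : Measure ℝ) [IsFiniteMeasure l] :
    ∃ μ : Measure ℝ, IsProbabilityMeasure μ ∧
      ∀ t, charFun μ t = Complex.exp (charFun l t - l.real Set.univ) := by
  set c := l.real Set.univ with hc
  have hc0 : 0 ≤ c := measureReal_nonneg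
  -- For `n > c` the quantity `n * (charFun (p n) t - 1)` equals `charFun l t - c` exactly. For the
  -- finitely many other `n` the weight `1 - c / n` might be negative or meaningless, and any
  -- probability measure will do.
  let p : ℕ → Measure ℝ := fun n => if c < n then
    ENNReal.ofReal (1 - c / n) • Measure.dirac 0 + ENNReal.ofReal (1 / n) • l
    else Measure.dirac 0
  refine exists_charFun_eq_exp_of_tendsto_mul (ψ := fun t => charFun l t - c) (by fun_prop) p
    (fun n => ?_) fun t => ?_
  · by_cases hn : c < n
    · have hn0 : (0 : ℝ) < n := hc0.trans_lt hn
      simp only [p, if_pos hn]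
      constructor
      have hl : l Set.univ = ENNReal.ofReal c := by simp [hc]
      have h1 : c / n ≤ 1 := (div_le_one hn0).2 hn.le
      simp only [Measure.coe_add, Measure.coe_smul, Pi.add_apply, Pi.smul_apply, measure_univ,
        smul_eq_mul, mul_one, hl]
      rw [← ENNReal.ofReal_mul (by positivity), ← ENNReal.ofReal_add (by linarith) (by positivity),
        ← ENNReal.ofReal_one]
      congr 1
      ring
    · simp only [p, if_neg hn]
      infer_instance
  · refine tendsto_const_nhds.congr' ?_
    filter_upwards [eventually_gt_atTop ⌈c⌉₊] with n hn
    have hn' : c < n := Nat.lt_of_ceil_lt hn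
    have hn0 : (0 : ℝ) < n := hc0.trans_lt hn'
    have h1 : c / n ≤ 1 := (div_le_one hn0).2 hn'.le
    have hnC : (n : ℂ) ≠ 0 := by exact_mod_cast hn0.ne'
    simp only [p, if_pos hn', charFun_apply_real]
    have hb : ∀ x : ℝ, ‖Complex.exp (t * x * Complex.I)‖ ≤ 1 := fun x => by
      rw [show (t * x * Complex.I : ℂ) = Complex.I * t * x by ring, norm_exp_I_mul]
    rw [integral_add_measure
      ((integrable_of_continuous_of_norm_le (by fun_prop) hb).smul_measure (by simp))
      ((integrable_of_continuous_of_norm_le (by fun_prop) hb).smul_measure (by simp)),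
      integral_smul_measure, integral_smul_measure, integral_dirac,
      ENNReal.toReal_ofReal (by linarith), ENNReal.toReal_ofReal (by positivity)]
    generalize ∫ x : ℝ, Complex.exp (t * x * Complex.I) ∂l = A
    simp only [Complex.ofReal_zero, mul_zero, zero_mul, Complex.exp_zero, Complex.real_smul]
    push_cast
    field_simp
    ring

/-- Away from `0` the density `(1 + u²) / u²` is bounded, so the kernel integral splits into a
compound Poisson exponent and the compensator `it ∫ u⁻¹ dM`, which a translation absorbs. -/
lemma exists_charFun_eq_exp_measureExponent_of_le (γ : ℝ) (M : Measure ℝ) [IsFiniteMeasure M]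
    {ε : ℝ} (hε : 0 < ε) (hM : ∀ᵐ u ∂M, ε ≤ |u|) :
    ∃ μ : Measure ℝ, IsProbabilityMeasure μ ∧
      ∀ t, charFun μ t = Complex.exp (measureExponent γ M t) := by
  have hne : ∀ᵐ u ∂M, u ≠ 0 := by
    filter_upwards [hM] with u hu h0
    simp [h0] at hu
    linarith
  have hd0 : ∀ u : ℝ, 0 ≤ (1 + u ^ 2) / u ^ 2 := fun u => by positivity
  have hdint : Integrable (fun u : ℝ => (1 + u ^ 2) / u ^ 2) M := by
    refine Integrable.of_bound (by fun_prop : Measurable _).aestronglyMeasurable (1 / ε ^ 2 + 1) ?_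
    filter_upwards [hM, hne] with u hu hu0
    rw [Real.norm_eq_abs, abs_of_nonneg (hd0 u), add_div, div_self (pow_ne_zero 2 hu0)]
    rw [← sq_abs u]
    gcongr
  have hinvint : Integrable (fun u : ℝ => (u⁻¹ : ℂ)) M := by
    refine Integrable.of_bound (by fun_prop) ε⁻¹ ?_
    filter_upwards [hM, hne] with u hu hu0
    rw [norm_inv, Complex.norm_real, Real.norm_eq_abs]
    gcongr
  set l := M.withDensity fun u => ENNReal.ofReal ((1 + u ^ 2) / u ^ 2) with hl
  have : IsFiniteMeasure l := isFiniteMeasure_withDensity_ofReal hdint.2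
  have hlint : ∀ f : ℝ → ℂ, ∫ u, f u ∂l = ∫ u, f u * ((1 + u ^ 2) / u ^ 2 : ℂ) ∂M := by
    intro f
    rw [hl, integral_withDensity_eq_integral_toReal_smul (by fun_prop) (by simp)]
    congr with u
    rw [ENNReal.toReal_ofReal (hd0 u), Complex.real_smul]
    push_cast
    ring
  obtain ⟨μ, hμ, hμl⟩ := exists_charFun_eq_exp_charFun_sub l
  set r := γ - ∫ u, u⁻¹ ∂M with hr
  refine ⟨μ.map (· + r), Measure.isProbabilityMeasure_map (by fun_prop), fun t => ?_⟩
  rw [charFun_map_add_const, hμl, ← Complex.exp_add]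
  congr 1
  have hdintC : Integrable (fun u : ℝ => ((1 + u ^ 2) / u ^ 2 : ℂ)) M := by
    convert! hdint.ofReal (𝕜 := ℂ) using 2 with u
    simp
  have h1 : charFun l t = ∫ u, Complex.exp (t * u * Complex.I) * ((1 + u ^ 2) / u ^ 2 : ℂ) ∂M := by
    rw [charFun_apply_real, hlint]
  have h2 : (l.real Set.univ : ℂ) = ∫ u, ((1 + u ^ 2) / u ^ 2 : ℂ) ∂M := by
    rw [← charFun_zero, charFun_apply_real, hlint]
    simp
  have h3 : ((∫ u, u⁻¹ ∂M : ℝ) : ℂ) = ∫ u, (u⁻¹ : ℂ) ∂M := by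
    rw [← integral_complex_ofReal]; simp
  have hexp : Integrable (fun u : ℝ => Complex.exp (t * u * Complex.I)
      * ((1 + u ^ 2) / u ^ 2 : ℂ)) M := by
    refine hdintC.bdd_mul (c := 1) (by fun_prop) (Eventually.of_forall fun u => ?_)
    rw [show (t * u * Complex.I : ℂ) = Complex.I * t * u by ring, norm_exp_I_mul]
  have h4 : ∫ u, kernel t u ∂M = charFun l t - l.real Set.univ
      - Complex.I * t * (∫ u, u⁻¹ ∂M : ℝ) := by
    rw [h1, h2, h3, ← integral_sub hexp hdintC, ← integral_const_mul]
    refine Eq.trans ?_ (integral_sub (hexp.sub hdintC) (hinvint.const_mul _))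
    apply integral_congr_ae
    filter_upwards [hne] with u hu
    have hu' : (u : ℂ) ≠ 0 := by exact_mod_cast hu
    have h2 : (1 + (u : ℂ) ^ 2) ≠ 0 := by
      have : (1 + u ^ 2 : ℝ) ≠ 0 := by positivity
      exact_mod_cast this
    rw [kernel, if_neg hu, show (t * u * Complex.I : ℂ) = Complex.I * t * u by ring]
    field_simp
  rw [measureExponent, h4, hr]
  simp
  ring

lemma exists_charFun_eq_exp_measureExponent (γ : ℝ) (M : Measure ℝ) [IsFiniteMeasure M] :
    ∃ μ : Measure ℝ, IsProbabilityMeasure μ ∧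
      ∀ t, charFun μ t = Complex.exp (measureExponent γ M t) := by
  let S : ℕ → Set ℝ := fun k => {u | 1 / ((k : ℝ) + 1) ≤ |u|}
  have hS : ∀ k, MeasurableSet (S k) := fun k => measurableSet_le (by fun_prop) (by fun_prop)
  choose p hp hpS using fun k => exists_charFun_eq_exp_measureExponent_of_le 0 (M.restrict (S k))
    (ε := 1 / ((k : ℝ) + 1)) (by positivity) (ae_restrict_mem (hS k))
  obtain ⟨μ, hμ, hμM⟩ := exists_charFun_eq_exp_of_tendsto_exp
    (ψ := measureExponent 0 (M.restrict {0}ᶜ)) (continuous_measureExponent 0) p hp fun t => by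
      simp_rw [hpS]
      refine (Complex.continuous_exp.tendsto _).comp ?_
      unfold measureExponent
      refine tendsto_const_nhds.add ?_
      simp_rw [← integral_indicator (hS _)]
      rw [← integral_indicator (MeasurableSet.singleton 0).compl]
      refine tendsto_integral_of_dominated_convergence (fun _ => 4 + |t| + 2 * t ^ 2)
        (fun k => ((continuous_kernel_right t).measurable.indicator (hS k)).aestronglyMeasurable)
        (integrable_const _) (fun k => Eventually.of_forall fun u =>
          (norm_indicator_le_norm_self _ _).trans (norm_kernel_le t u))
        (Eventually.of_forall fun u => ?_)
      rcases eq_or_ne u 0 with rfl | hu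
      · refine tendsto_const_nhds.congr fun k => ?_
        have : (0 : ℝ) ∉ S k := by
          simp only [S, Set.mem_ofPred_eq, abs_zero, not_le]; positivity
        simp [this]
      · refine tendsto_const_nhds.congr' ?_
        have hlim := tendsto_one_div_add_atTop_nhds_zero_nat (𝕜 := ℝ)
        filter_upwards [hlim.eventually (gt_mem_nhds (abs_pos.2 hu))] with k hk
        rw [Set.indicator_of_mem (by simpa using hu), Set.indicator_of_mem (show u ∈ S k from hk.le)]
  -- Since `kernel t 0 = -t²/2`, the atom at `0` is a Gaussian variance; the drift `γ` enters as its
  -- mean.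
  refine ⟨μ.conv (ProbabilityTheory.gaussianReal γ (M {0}).toNNReal), inferInstance, fun t => ?_⟩
  rw [charFun_conv, hμM, ProbabilityTheory.charFun_gaussianReal, ← Complex.exp_add]
  congr 1
  have h0 : ∫ u in {(0 : ℝ)}, kernel t u ∂M = -((M {0}).toNNReal * (t : ℂ) ^ 2 / 2) := by
    simp [kernel, ENNReal.toReal]
    ring
  simp only [measureExponent]
  rw [← integral_add_compl (μ := M) (MeasurableSet.singleton (0 : ℝ)) (integrable_kernel t), h0]
  simp only [Complex.ofReal_zero]
  ring

/-! ### The exponent of an infinitely divisible distribution -/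

/-- Integrates `1 - cos 2θ ≤ 4 (1 - cos θ)`, whose two sides differ by `2 (1 - cos θ)²`. -/
lemma one_sub_re_charFun_two_mul_le (μ : Measure ℝ) [IsProbabilityMeasure μ] (t : ℝ) :
    1 - (charFun μ (2 * t)).re ≤ 4 * (1 - (charFun μ t).re) := by
  have hint : ∀ s : ℝ, Integrable (fun x : ℝ => Real.cos (s * x)) μ := fun s =>
    integrable_of_continuous_of_norm_le (by fun_prop) (C := 1) fun x => Real.abs_cos_le_one _
  have hre : ∀ s : ℝ, (charFun μ s).re = ∫ x, Real.cos (s * x) ∂μ := by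
    intro s
    rw [charFun_apply_real, ← RCLike.re_eq_complex_re, ← integral_re]
    · congr with x
      rw [RCLike.re_eq_complex_re, ← Complex.ofReal_mul, Complex.exp_ofReal_mul_I_re]
    · refine integrable_of_continuous_of_norm_le (by fun_prop) (C := 1) fun x => ?_
      rw [show (s * x * Complex.I : ℂ) = Complex.I * s * x by ring, norm_exp_I_mul]
  have h1 : ∀ s : ℝ, 1 - (charFun μ s).re = ∫ x, (1 - Real.cos (s * x)) ∂μ := by
    intro s
    rw [integral_sub (integrable_const _) (hint s), hre]
    simp
  rw [h1, h1, ← integral_const_mul]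
  refine integral_mono ((integrable_const _).sub (hint _))
    (((integrable_const _).sub (hint _)).const_mul _) fun x => ?_
  simp only
  rw [mul_assoc, Real.cos_two_mul]
  nlinarith [sq_nonneg (1 - Real.cos (t * x))]

/-- Symmetrisation: `|charFun μ|²` is the characteristic function of `μ` convolved with its
reflection. -/
lemma one_sub_normSq_charFun_two_mul_le (μ : Measure ℝ) [IsProbabilityMeasure μ] (t : ℝ) :
    1 - ‖charFun μ (2 * t)‖ ^ 2 ≤ 4 * (1 - ‖charFun μ t‖ ^ 2) := by
  have : IsProbabilityMeasure (μ.map fun x => -1 * x) :=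
    Measure.isProbabilityMeasure_map (by fun_prop)
  have h : ∀ s, (charFun (μ.conv (μ.map fun x => -1 * x)) s).re = ‖charFun μ s‖ ^ 2 := by
    intro s
    rw [charFun_conv, charFun_map_mul, neg_one_mul, charFun_neg, Complex.mul_conj,
      Complex.ofReal_re, Complex.normSq_eq_norm_sq]
  have := one_sub_re_charFun_two_mul_le (μ.conv (μ.map fun x => -1 * x)) t
  rwa [h, h] at this

lemma one_sub_normSq_charFun_two_pow_mul_le (μ : Measure ℝ) [IsProbabilityMeasure μ] (t : ℝ)
    (k : ℕ) : 1 - ‖charFun μ (2 ^ k * t)‖ ^ 2 ≤ 4 ^ k * (1 - ‖charFun μ t‖ ^ 2) := by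
  induction k with
  | zero => simp
  | succ k ih =>
    have := one_sub_normSq_charFun_two_mul_le μ (2 ^ k * t)
    rw [pow_succ' (2 : ℝ), pow_succ' (4 : ℝ), mul_assoc, mul_assoc]
    linarith

/-- Choose `s = t / 2^k` so near `0` that `φ s ≠ 0`. The `n`-th root has modulus `‖φ s‖^(1/n) → 1`
at `s`, so for this fixed `k` and large `n` the doubling inequality keeps it nonzero at `t = 2^k s`.
-/
lemma ne_zero_of_forall_exists_charFun_pow {φ : ℝ → ℂ} (hφ : Continuous φ) (h0 : φ 0 = 1)
    (h : ∀ n : ℕ, 1 ≤ n → ∃ ν : Measure ℝ, IsProbabilityMeasure ν ∧ ∀ t, φ t = charFun ν t ^ n)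
    (t : ℝ) : φ t ≠ 0 := by
  have hev : ∀ᶠ s in 𝓝 0, φ s ≠ 0 := hφ.continuousAt.eventually_ne (by simp [h0])
  have hlim : Tendsto (fun k : ℕ => t / 2 ^ k) atTop (𝓝 0) :=
    tendsto_const_nhds.div_atTop (tendsto_pow_atTop_atTop_of_one_lt one_lt_two)
  obtain ⟨k, hk⟩ := (hlim.eventually hev).exists
  set s := t / 2 ^ k with hs
  have hts : t = 2 ^ k * s := by rw [hs]; field_simp
  have hr : 0 < ‖φ s‖ := norm_pos_iff.2 hk
  choose! ν hν hνφ using h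
  have hroot : ∀ n : ℕ, 1 ≤ n → ‖charFun (ν n) s‖ = ‖φ s‖ ^ (1 / (n : ℝ)) := by
    intro n hn
    rw [hνφ n hn s, norm_pow, one_div, Real.pow_rpow_inv_natCast (norm_nonneg _) (by omega)]
  have hlim2 : Tendsto (fun n : ℕ => 4 ^ k * (1 - (‖φ s‖ ^ (1 / (n : ℝ))) ^ 2)) atTop
      (𝓝 (4 ^ k * (1 - (‖φ s‖ ^ (0 : ℝ)) ^ 2))) := by
    have h1 : Tendsto (fun n : ℕ => 1 / (n : ℝ)) atTop (𝓝 0) := tendsto_one_div_atTop_nhds_zero_nat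
    exact ((((Real.continuousAt_const_rpow hr.ne').tendsto.comp h1).pow 2).const_sub 1).const_mul _
  simp only [Real.rpow_zero, one_pow, sub_self, mul_zero] at hlim2
  obtain ⟨n, hn, hn1⟩ := ((hlim2.eventually (gt_mem_nhds one_pos)).and
    (eventually_ge_atTop 1)).exists
  have := hν n hn1
  have h3 := one_sub_normSq_charFun_two_pow_mul_le (ν n) s k
  rw [← hts, hroot n hn1] at h3
  intro h4
  rw [hνφ n hn1 t] at h4
  rw [eq_zero_of_pow_eq_zero h4] at h3
  simp only [norm_zero, ne_eq, OfNat.ofNat_ne_zero, not_false_eq_true, zero_pow, sub_zero] at h3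
  linarith

lemma exists_isContinuousLog {φ : ℝ → ℂ} (hφ : Continuous φ) (h0 : φ 0 = 1)
    (hne : ∀ t, φ t ≠ 0) : ∃ ψ, IsContinuousLog φ ψ := by
  obtain ⟨f, ⟨hf0, hf⟩, -⟩ := Complex.isCoveringMapOn_exp.existsUnique_continuousMap_lifts
    ⟨φ, hφ⟩ (a₀ := 0) (e₀ := 0) (by simp [h0]) (by simpa using hne)
  exact ⟨f, f.continuous, hf0, fun t => congrFun hf t⟩

/-- The root has its own continuous logarithm, and `n` times it must be `ψ` by uniqueness; this
selects the right branch of the `n`-th root. -/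
lemma IsContinuousLog.of_pow {φ φ' ψ : ℝ → ℂ} {n : ℕ} (h : IsContinuousLog φ ψ)
    (hφ' : Continuous φ') (h0 : φ' 0 = 1) (hpow : ∀ t, φ t = φ' t ^ n) (t : ℝ) (hn : n ≠ 0) :
    φ' t = Complex.exp (ψ t / n) := by
  obtain ⟨ψ', hψ'⟩ := exists_isContinuousLog hφ' h0 fun t h1 => by
    have := hpow t
    rw [h1, zero_pow hn, ← h.exp_eq] at this
    exact Complex.exp_ne_zero _ this
  have h2 : IsContinuousLog φ fun t => n * ψ' t := by
    refine ⟨continuous_const.mul hψ'.continuous, by simp [hψ'.map_zero], fun t => ?_⟩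
    rw [Complex.exp_nat_mul, hψ'.exp_eq, hpow]
  rw [h.unique h2, mul_div_cancel_left₀ _ (by exact_mod_cast hn), hψ'.exp_eq]

/-- Take `M = r u²/(1+u²) dν`, cancelling the singular factor of the kernel, and let `γ = r ∫
u/(1+u²) dν` offset the compensator. An atom of `ν` at `0` is lost harmlessly, since `e^{it·0} - 1 =
0`. -/
lemma exists_measureExponent_eq_mul_charFun_sub_one (ν : Measure ℝ) [IsProbabilityMeasure ν]
    (r : NNReal) : ∃ (γ : ℝ) (M : Measure ℝ), IsFiniteMeasure M ∧
      ∀ t, measureExponent γ M t = r * (charFun ν t - 1) := by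
  have hd0 : ∀ u : ℝ, 0 ≤ u ^ 2 / (1 + u ^ 2) := fun u => by positivity
  have hpos : ∀ u : ℝ, (1 + u ^ 2 : ℝ) ≠ 0 := fun u => by positivity
  have hdint : Integrable (fun u : ℝ => u ^ 2 / (1 + u ^ 2)) ν := by
    refine integrable_of_continuous_of_norm_le (C := 1) (by fun_prop (disch := simp [hpos]))
      fun u => ?_
    rw [Real.norm_eq_abs, abs_of_nonneg (hd0 u), div_le_one (by positivity)]
    linarith
  have hgint : Integrable (fun u : ℝ => u / (1 + u ^ 2)) ν := by
    refine integrable_of_continuous_of_norm_le (C := 1) (by fun_prop (disch := simp [hpos]))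
      fun u => ?_
    rw [Real.norm_eq_abs, abs_div, abs_of_nonneg (show 0 ≤ 1 + u ^ 2 by positivity),
      div_le_one (by positivity), ← sq_abs]
    nlinarith [sq_nonneg (|u| - 1), abs_nonneg u]
  set l := ν.withDensity fun u => ENNReal.ofReal (u ^ 2 / (1 + u ^ 2)) with hl
  have : IsFiniteMeasure l := isFiniteMeasure_withDensity_ofReal hdint.2
  refine ⟨r * ∫ u, u / (1 + u ^ 2) ∂ν, r • l, inferInstance, fun t => ?_⟩
  have h1 : ∫ u, kernel t u ∂l = ∫ u, (Complex.exp (t * u * Complex.I) - 1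
      - Complex.I * t * ((u / (1 + u ^ 2) : ℝ) : ℂ)) ∂ν := by
    rw [hl, integral_withDensity_eq_integral_toReal_smul (by fun_prop) (by simp)]
    congr with u
    rw [ENNReal.toReal_ofReal (hd0 u), Complex.real_smul]
    rcases eq_or_ne u 0 with rfl | hu
    · simp
    · have hu' : (u : ℂ) ≠ 0 := by exact_mod_cast hu
      have h2 : (1 + (u : ℂ) ^ 2) ≠ 0 := by exact_mod_cast hpos u
      rw [kernel, if_neg hu, show (t * u * Complex.I : ℂ) = Complex.I * t * u by ring]
      push_cast
      field_simp
  have hexp : Integrable (fun u : ℝ => Complex.exp (t * u * Complex.I)) ν := by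
    refine integrable_of_continuous_of_norm_le (by fun_prop) (C := 1) fun x => ?_
    rw [show (t * x * Complex.I : ℂ) = Complex.I * t * x by ring, norm_exp_I_mul]
  have h2 : ∫ u, kernel t u ∂l
      = charFun ν t - 1 - Complex.I * t * (∫ u, u / (1 + u ^ 2) ∂ν : ℝ) := by
    have hg : Integrable (fun u : ℝ => ((u / (1 + u ^ 2) : ℝ) : ℂ)) ν := hgint.ofReal
    rw [h1]
    refine (integral_sub (hexp.sub (integrable_const _)) (hg.const_mul _)).trans ?_
    rw [integral_const_mul, integral_complex_ofReal]
    simp only [Pi.sub_apply]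
    rw [integral_sub hexp (integrable_const _), ← charFun_apply_real]
    simp
  rw [measureExponent, integral_smul_nnreal_measure, h2, NNReal.smul_def, Complex.real_smul]
  push_cast
  ring

lemma continuous_secondDiff {ψ : ℝ → ℂ} (hψ : Continuous ψ) : Continuous (secondDiff ψ) := by
  have hF : Continuous fun x => ∫ α in (0 : ℝ)..x, ψ α :=
    intervalIntegral.continuous_primitive (fun a b => hψ.intervalIntegrable a b) 0
  have h : secondDiff ψ = fun t =>
      (∫ α in (0 : ℝ)..(t + 1), ψ α) - (∫ α in (0 : ℝ)..(t - 1), ψ α) - 2 * ψ t := by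
    ext t
    rw [secondDiff, intervalIntegral.integral_interval_sub_left (hψ.intervalIntegrable _ _)
      (hψ.intervalIntegrable _ _)]
  rw [h]
  exact ((hF.comp (by fun_prop)).sub (hF.comp (by fun_prop))).sub (hψ.const_mul 2)

/-- Closedness of the class of exponents. The bound `B` lets pointwise convergence pass through the
integral in `secondDiff`, giving convergent characteristic functions of the weighted measures. -/
lemma exists_measureExponent_eq_of_tendsto {ψ : ℝ → ℂ} (hψ : Continuous ψ) {B : ℝ → ℝ}
    (hB : Continuous B) (γ : ℕ → ℝ) (M : ℕ → Measure ℝ) (hM : ∀ n, IsFiniteMeasure (M n))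
    (hbound : ∀ n t, ‖measureExponent (γ n) (M n) t‖ ≤ B t)
    (h : ∀ t, Tendsto (fun n => measureExponent (γ n) (M n) t) atTop (𝓝 (ψ t))) :
    ∃ (γ₀ : ℝ) (M₀ : Measure ℝ), IsFiniteMeasure M₀ ∧ ψ = measureExponent γ₀ M₀ := by
  obtain ⟨W, hW, -, hlim⟩ := exists_measure_of_tendsto_charFun (fun n => weightedMeasure (M n))
    (g := fun t => -secondDiff ψ t) (continuous_secondDiff hψ).neg.continuousAt fun t => by
      have hcf := fun n => charFun_weightedMeasure (M := M n) (γ n) t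
      simp_rw [hcf]
      refine Tendsto.neg (Tendsto.sub ?_ ((h t).const_mul 2))
      refine intervalIntegral.tendsto_integral_filter_of_dominated_convergence B
        (Eventually.of_forall fun n => (continuous_measureExponent _).aestronglyMeasurable)
        (Eventually.of_forall fun n => Eventually.of_forall fun α _ => hbound n α)
        (hB.intervalIntegrable _ _) (Eventually.of_forall fun α _ => h α)
  obtain ⟨c, hc, hwc⟩ := exists_weight_le
  have hinv : Continuous fun u => (-weight u)⁻¹ :=
    continuous_weight.neg.inv₀ fun u => (neg_pos.2 (weight_neg u)).ne'
  have hinv0 : ∀ u, 0 ≤ (-weight u)⁻¹ := fun u => inv_nonneg.2 (neg_pos.2 (weight_neg u)).le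
  have hinvle : ∀ u, ‖(-weight u)⁻¹‖ ≤ c⁻¹ := by
    intro u
    rw [Real.norm_eq_abs, abs_of_nonneg (hinv0 u)]
    exact inv_anti₀ hc (by linarith [hwc u])
  set M₀ := W.withDensity fun u => ENNReal.ofReal (-weight u)⁻¹ with hM₀
  have : IsFiniteMeasure M₀ := isFiniteMeasure_withDensity_ofReal
    (integrable_of_continuous_of_norm_le hinv hinvle).2
  have hk : ∀ t, Tendsto (fun n => ∫ u, kernel t u ∂(M n)) atTop (𝓝 (∫ u, kernel t u ∂M₀)) := by
    intro t
    -- The test function `kernel t / (-weight)` is bounded and continuous; the weight then cancels,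
    -- leaving convergence of the unweighted kernel integrals.
    have := hlim (BoundedContinuousFunction.ofNormedAddCommGroup
      (fun u => (-weight u)⁻¹ • kernel t u) (hinv.smul (continuous_kernel_right t))
      (c⁻¹ * (4 + |t| + 2 * t ^ 2)) fun u => by
        rw [norm_smul]
        exact mul_le_mul (hinvle u) (norm_kernel_le t u) (norm_nonneg _) (inv_nonneg.2 hc.le))
    simp only [BoundedContinuousFunction.coe_ofNormedAddCommGroup, integral_weightedMeasure] at this
    simp only [smul_inv_smul₀ (neg_pos.2 (weight_neg _)).ne'] at this
    convert! this using 2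
    rw [hM₀, integral_withDensity_eq_integral_toReal_smul (by fun_prop) (by simp)]
    congr with u
    rw [ENNReal.toReal_ofReal (hinv0 u)]
  have hγ : ∀ t : ℝ, Tendsto (fun n => Complex.I * γ n * t) atTop (𝓝 (ψ t - ∫ u, kernel t u ∂M₀)) := by
    intro t
    refine ((h t).sub (hk t)).congr fun n => ?_
    rw [measureExponent, add_sub_cancel_right]
  set γ₀ := (ψ 1 - ∫ u, kernel 1 u ∂M₀).im with hγ₀
  have hlimγ : Tendsto γ atTop (𝓝 γ₀) := by
    have := (Complex.continuous_im.tendsto _).comp (hγ 1)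
    refine this.congr fun n => ?_
    simp
  refine ⟨γ₀, M₀, this, funext fun t => ?_⟩
  have h1 : Tendsto (fun n => Complex.I * γ n * t) atTop (𝓝 (Complex.I * γ₀ * t)) :=
    (((Complex.continuous_ofReal.tendsto _).comp hlimγ).const_mul _).mul_const _
  rw [measureExponent, tendsto_nhds_unique h1 (hγ t), sub_add_cancel]

lemma tendsto_mul_exp_div_sub_one (z : ℂ) :
    Tendsto (fun n : ℕ => n * (Complex.exp (z / n) - 1)) atTop (𝓝 z) := by
  have hd : HasDerivAt (fun w : ℂ => Complex.exp (z * w)) z 0 := by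
    simpa using ((hasDerivAt_id (0 : ℂ)).const_mul z).cexp
  have hlim : Tendsto (fun n : ℕ => (n : ℂ)⁻¹) atTop (𝓝[≠] 0) :=
    tendsto_nhdsWithin_iff.2 ⟨tendsto_inv_atTop_nhds_zero_nat,
      (eventually_ne_atTop 0).mono fun n hn => by simpa using hn⟩
  have := hd.tendsto_slope_zero.comp hlim
  refine this.congr fun n => ?_
  simp [div_eq_mul_inv]

/-- Supplies the dominating function `B`, independent of `n`. -/
lemma norm_mul_exp_div_sub_one_le (z : ℂ) (n : ℕ) :
    ‖(n : ℂ) * (Complex.exp (z / n) - 1)‖ ≤ ‖z‖ * Real.exp ‖z‖ := by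
  rcases Nat.eq_zero_or_pos n with rfl | hn
  · simp; positivity
  have hn' : (1 : ℝ) ≤ n := by exact_mod_cast hn
  have h := Complex.norm_exp_sub_sum_le_norm_mul_exp (z / n) 1
  simp only [Finset.range_one, Finset.sum_singleton, pow_zero, Nat.factorial_zero, Nat.cast_one,
    div_one, pow_one, norm_div, Complex.norm_natCast] at h
  rw [norm_mul, Complex.norm_natCast]
  calc _ ≤ n * (‖z‖ / n * Real.exp (‖z‖ / n)) := by gcongr
    _ = ‖z‖ * Real.exp (‖z‖ / n) := by field_simp
    _ ≤ _ := by gcongr; exact div_le_self (norm_nonneg _) hn'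

theorem isInfinitelyDivisibleCharFun_iff (φ : ℝ → ℂ) : IsInfinitelyDivisibleCharFun φ ↔
    ∃ (γ : ℝ) (M : Measure ℝ), IsFiniteMeasure M ∧ IsContinuousLog φ (measureExponent γ M) := by
  constructor
  · rintro ⟨μ, ⟨hμ, hdiv⟩, hφ⟩
    have hφ' : φ = charFun μ := funext hφ
    have hcont : Continuous φ := by rw [hφ']; fun_prop
    have h0 : φ 0 = 1 := by simp [hφ']
    have hroot : ∀ n : ℕ, 1 ≤ n → ∃ ν : Measure ℝ, IsProbabilityMeasure ν ∧
        ∀ t, φ t = charFun ν t ^ n := by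
      intro n hn
      obtain ⟨ν, hν, hμν⟩ := hdiv n hn
      exact ⟨ν, hν, fun t => by rw [hφ, hμν, charFun_map_sum_pi_const]⟩
    obtain ⟨ψ, hψ⟩ := exists_isContinuousLog hcont h0
      (ne_zero_of_forall_exists_charFun_pow hcont h0 hroot)
    have hex : ∀ n : ℕ, ∃ (γ : ℝ) (M : Measure ℝ), IsFiniteMeasure M ∧
        ∀ t, measureExponent γ M t = n * (Complex.exp (ψ t / n) - 1) := by
      intro n
      rcases Nat.eq_zero_or_pos n with rfl | hn
      · exact ⟨0, 0, inferInstance, fun t => by simp [measureExponent]⟩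
      · obtain ⟨ν, hν, hνφ⟩ := hroot n hn
        obtain ⟨γ, M, hM, h⟩ := exists_measureExponent_eq_mul_charFun_sub_one ν n
        refine ⟨γ, M, hM, fun t => ?_⟩
        rw [h, hψ.of_pow (by fun_prop) (by simp) hνφ t hn.ne']
        simp
    choose γ M hM hγM using hex
    have := hψ.continuous
    obtain ⟨γ₀, M₀, hM₀, h⟩ := exists_measureExponent_eq_of_tendsto hψ.continuous
      (B := fun t => ‖ψ t‖ * Real.exp ‖ψ t‖) (by fun_prop) γ M hM
      (fun n t => by rw [hγM]; exact norm_mul_exp_div_sub_one_le _ _)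
      (fun t => by simp_rw [hγM]; exact tendsto_mul_exp_div_sub_one _)
    exact ⟨γ₀, M₀, hM₀, h ▸ hψ⟩
  · rintro ⟨γ, M, hM, h⟩
    obtain ⟨μ, hμ, hμM⟩ := exists_charFun_eq_exp_measureExponent γ M
    refine ⟨μ, ⟨hμ, fun n hn => ?_⟩, fun t => by rw [hμM, h.exp_eq]⟩
    obtain ⟨ν, hν, hνM⟩ := exists_charFun_eq_exp_measureExponent (γ / n) ((n : NNReal)⁻¹ • M)
    refine ⟨ν, hν, ?_⟩
    have : IsProbabilityMeasure ((Measure.pi fun _ : Fin n => ν).map fun x => ∑ i, x i) :=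
      Measure.isProbabilityMeasure_map (by fun_prop)
    apply Measure.ext_of_charFun
    ext t
    have hn0 : (n : ℂ) ≠ 0 := by exact_mod_cast (by omega : n ≠ 0)
    rw [charFun_map_sum_pi_const, hμM, hνM, ← Complex.exp_nat_mul]
    congr 1
    simp only [measureExponent]
    rw [integral_smul_nnreal_measure, NNReal.smul_def, Complex.real_smul]
    push_cast
    field_simp

/-! ### The Dirichlet integral -/

lemma integral_sin_mul_exp_neg_mul (T y : ℝ) :
    ∫ x in (0 : ℝ)..T, Real.sin x * Real.exp (-(x * y))
      = (1 - Real.exp (-(T * y)) * (Real.cos T + y * Real.sin T)) / (1 + y ^ 2) := by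
  have hpos : (1 + y ^ 2 : ℝ) ≠ 0 := by positivity
  have h : ∀ x ∈ Set.uIcc 0 T, HasDerivAt
      (fun x => -(Real.exp (-(x * y)) * (Real.cos x + y * Real.sin x)) / (1 + y ^ 2))
      (Real.sin x * Real.exp (-(x * y))) x := by
    intro x _
    have h1 : HasDerivAt (fun x => Real.exp (-(x * y))) (Real.exp (-(x * y)) * -(1 * y)) x :=
      ((hasDerivAt_id x).mul_const y).neg.exp
    have h2 := (Real.hasDerivAt_cos x).add ((Real.hasDerivAt_sin x).const_mul y)
    convert! ((h1.mul h2).neg).div_const (1 + y ^ 2) using 1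
    simp only [Pi.add_apply]
    field_simp
    ring
  rw [intervalIntegral.integral_eq_sub_of_hasDerivAt h
    (Continuous.intervalIntegrable (by fun_prop) _ _)]
  simp
  ring

lemma integral_sin_mul_exp_neg_Ioi {x : ℝ} (hx : 0 < x) (a : ℝ) :
    ∫ y in Set.Ioi (0 : ℝ), a * Real.exp (-(x * y)) = a / x := by
  have := integral_exp_mul_Ioi (a := -x) (by linarith) 0
  simp only [neg_mul, mul_zero, Real.exp_zero, neg_div_neg_eq] at this
  rw [integral_const_mul, this]
  ring

lemma integrableOn_exp_neg_mul_Ioi {x : ℝ} (hx : 0 < x) :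
    IntegrableOn (fun y => Real.exp (-(x * y))) (Set.Ioi 0) := by
  simpa using integrableOn_exp_mul_Ioi (a := -x) (by linarith) 0

/-- Writes `1/x = ∫₀^∞ e^{-xy} dy` and swaps the integrals; Fubini applies because integrating the
absolute value over `y` gives `|sinc x|`. -/
lemma integral_sinc_eq {T : ℝ} (hT : 0 < T) : ∫ x in (0 : ℝ)..T, Real.sinc x
    = ∫ y in Set.Ioi (0 : ℝ),
      (1 - Real.exp (-(T * y)) * (Real.cos T + y * Real.sin T)) / (1 + y ^ 2) := by
  have hint : Integrable (Function.uncurry fun x y : ℝ => Real.sin x * Real.exp (-(x * y)))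
      ((volume.restrict (Set.Ioc 0 T)).prod (volume.restrict (Set.Ioi 0))) := by
    refine (integrable_prod_iff (by unfold Function.uncurry; fun_prop)).2 ⟨?_, ?_⟩
    · refine ae_restrict_of_forall_mem measurableSet_Ioc fun x hx => ?_
      exact (integrableOn_exp_neg_mul_Ioi hx.1).const_mul (Real.sin x)
    · have : IntegrableOn (fun x => |Real.sinc x|) (Set.Ioc 0 T) :=
        (Real.continuous_sinc.abs.integrableOn_Icc).mono_set Set.Ioc_subset_Icc_self
      refine this.congr_fun (fun x hx => ?_) measurableSet_Ioc
      simp only [Function.uncurry, norm_mul, Real.norm_eq_abs, Real.abs_exp]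
      rw [integral_sin_mul_exp_neg_Ioi hx.1, Real.sinc_of_ne_zero hx.1.ne', abs_div,
        abs_of_pos hx.1]
  have h1 : ∫ x in (0 : ℝ)..T, Real.sinc x = ∫ x in Set.Ioc 0 T, ∫ y in Set.Ioi (0 : ℝ),
      Real.sin x * Real.exp (-(x * y)) := by
    rw [intervalIntegral.integral_of_le hT.le]
    refine setIntegral_congr_fun measurableSet_Ioc fun x hx => ?_
    rw [integral_sin_mul_exp_neg_Ioi hx.1, Real.sinc_of_ne_zero hx.1.ne']
  rw [h1, integral_integral_swap hint]
  congr with y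
  rw [← integral_sin_mul_exp_neg_mul, intervalIntegral.integral_of_le hT.le]

lemma abs_integral_sinc_sub_le {T : ℝ} (hT : 0 < T) :
    |(∫ x in (0 : ℝ)..T, Real.sinc x) - Real.pi / 2| ≤ 2 / T := by
  have hpi : ∫ y in Set.Ioi (0 : ℝ), (1 + y ^ 2)⁻¹ = Real.pi / 2 := by
    rw [integral_Ioi_inv_one_add_sq]; simp
  have hle : ∀ y ∈ Set.Ioi (0 : ℝ),
      ‖Real.exp (-(T * y)) * (Real.cos T + y * Real.sin T) / (1 + y ^ 2)‖
        ≤ 2 * Real.exp (-(T * y)) := by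
    intro y hy
    have hy : 0 < y := hy
    have h1 : |Real.cos T + y * Real.sin T| ≤ 1 + y := by
      refine (abs_add_le _ _).trans (add_le_add (Real.abs_cos_le_one T) ?_)
      rw [abs_mul, abs_of_pos hy]
      exact mul_le_of_le_one_right hy.le (Real.abs_sin_le_one T)
    have h2 : (1 + y) ≤ 2 * (1 + y ^ 2) := by nlinarith [sq_nonneg (y - 1)]
    rw [Real.norm_eq_abs, abs_div, abs_mul, Real.abs_exp,
      abs_of_nonneg (show 0 ≤ 1 + y ^ 2 by positivity), div_le_iff₀ (by positivity)]
    calc _ ≤ Real.exp (-(T * y)) * (2 * (1 + y ^ 2)) := by gcongr; exact h1.trans h2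
      _ = _ := by ring
  have hdom : IntegrableOn (fun y => 2 * Real.exp (-(T * y))) (Set.Ioi 0) :=
    (integrableOn_exp_neg_mul_Ioi hT).const_mul 2
  have hR : IntegrableOn (fun y : ℝ => Real.exp (-(T * y)) * (Real.cos T + y * Real.sin T)
      / (1 + y ^ 2)) (Set.Ioi 0) :=
    Integrable.mono' hdom (by
      have : Measurable fun y : ℝ => Real.exp (-(T * y)) * (Real.cos T + y * Real.sin T)
        / (1 + y ^ 2) := by fun_prop
      exact this.aestronglyMeasurable)
      (ae_restrict_of_forall_mem measurableSet_Ioi hle)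
  have hsub : (∫ x in (0 : ℝ)..T, Real.sinc x) - Real.pi / 2 = -∫ y in Set.Ioi (0 : ℝ),
      Real.exp (-(T * y)) * (Real.cos T + y * Real.sin T) / (1 + y ^ 2) := by
    rw [integral_sinc_eq hT, ← hpi]
    simp only [sub_div, one_div]
    rw [integral_sub integrable_inv_one_add_sq.integrableOn hR]
    ring
  rw [hsub, abs_neg, ← Real.norm_eq_abs]
  refine (norm_integral_le_of_norm_le hdom
    (ae_restrict_of_forall_mem measurableSet_Ioi hle)).trans_eq ?_
  exact integral_sin_mul_exp_neg_Ioi hT 2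

/-- The symmetric sine integral `∫_{-x}^x sin y / y dy`. -/
noncomputable def symmSinc (x : ℝ) : ℝ := ∫ y in (-x)..x, Real.sinc y

lemma symmSinc_neg (x : ℝ) : symmSinc (-x) = -symmSinc x := by
  rw [symmSinc, symmSinc, neg_neg, intervalIntegral.integral_symm]

lemma continuous_symmSinc : Continuous symmSinc := by
  have hF : Continuous fun x => ∫ y in (0 : ℝ)..x, Real.sinc y :=
    intervalIntegral.continuous_primitive
      (fun a b => Real.continuous_sinc.intervalIntegrable a b) 0
  have h : symmSinc = fun x =>
      (∫ y in (0 : ℝ)..x, Real.sinc y) - ∫ y in (0 : ℝ)..(-x), Real.sinc y := by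
    ext x
    rw [symmSinc, intervalIntegral.integral_interval_sub_left
      (Real.continuous_sinc.intervalIntegrable _ _) (Real.continuous_sinc.intervalIntegrable _ _)]
  rw [h]
  exact hF.sub (hF.comp continuous_neg)

lemma symmSinc_eq (x : ℝ) : symmSinc x = 2 * ∫ y in (0 : ℝ)..x, Real.sinc y := by
  rw [symmSinc, ← intervalIntegral.integral_add_adjacent_intervals (b := 0)
    (Real.continuous_sinc.intervalIntegrable _ _) (Real.continuous_sinc.intervalIntegrable _ _)]
  have := intervalIntegral.integral_comp_neg (a := 0) (b := x) Real.sinc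
  simp only [Real.sinc_neg, neg_zero] at this
  rw [← this]
  ring

lemma abs_symmSinc_sub_pi_le {x : ℝ} (hx : 0 < x) : |symmSinc x - Real.pi| ≤ 4 / x := by
  have h := abs_integral_sinc_sub_le hx
  rw [symmSinc_eq, show 2 * (∫ y in (0 : ℝ)..x, Real.sinc y) - Real.pi
    = 2 * ((∫ y in (0 : ℝ)..x, Real.sinc y) - Real.pi / 2) by ring, abs_mul, abs_two]
  calc _ ≤ 2 * (2 / x) := by gcongr
    _ = _ := by ring

/-- Only uniformity matters: this is the domination for letting `T → ∞` under the integral over `v`.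
-/
lemma abs_symmSinc_le (x : ℝ) : |symmSinc x| ≤ 8 := by
  wlog hx : 0 ≤ x generalizing x
  · rw [← abs_neg, ← symmSinc_neg]
    exact this (-x) (by linarith)
  rcases le_or_gt x 1 with h1 | h1
  · have := intervalIntegral.norm_integral_le_of_norm_le_const (a := -x) (b := x)
      (f := Real.sinc) (C := 1) fun y _ => Real.abs_sinc_le_one y
    rw [Real.norm_eq_abs, abs_of_nonneg (by linarith : 0 ≤ x - -x)] at this
    exact this.trans (by linarith)
  · have h2 := abs_symmSinc_sub_pi_le (by linarith : 0 < x)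
    have h3 : 4 / x ≤ 4 := div_le_self (by norm_num) h1.le
    have h4 := abs_sub_abs_le_abs_sub (symmSinc x) Real.pi
    rw [abs_of_pos Real.pi_pos] at h4
    linarith [Real.pi_lt_four]

lemma tendsto_symmSinc_mul (v : ℝ) :
    Tendsto (fun T => symmSinc (T * v)) atTop (𝓝 (Real.pi * Real.sign v)) := by
  have hlim : Tendsto symmSinc atTop (𝓝 Real.pi) := by
    rw [tendsto_iff_norm_sub_tendsto_zero]
    refine squeeze_zero' (Eventually.of_forall fun _ => norm_nonneg _)
      ((eventually_gt_atTop 0).mono fun x hx => abs_symmSinc_sub_pi_le hx) ?_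
    exact tendsto_const_nhds.div_atTop tendsto_id
  rcases lt_trichotomy v 0 with hv | rfl | hv
  · rw [Real.sign_of_neg hv, mul_neg_one]
    have h := (hlim.comp (tendsto_id.atTop_mul_const (neg_pos.2 hv))).neg
    refine h.congr fun T => ?_
    simp [symmSinc_neg]
  · simp [symmSinc]
  · rw [Real.sign_of_pos hv, mul_one]
    exact hlim.comp (tendsto_id.atTop_mul_const hv)

/-! ### The inversion formula -/

lemma norm_one_sub_exp_div_le (t u : ℝ) :
    ‖(1 - Complex.exp (-(Complex.I * t * u))) / (Complex.I * t)‖ ≤ |u| := by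
  rcases eq_or_ne t 0 with rfl | ht
  · simp
  have h := Real.norm_exp_I_mul_ofReal_sub_one_le (x := -(t * u))
  rw [norm_div, norm_mul, Complex.norm_I, one_mul, Complex.norm_real, Real.norm_eq_abs,
    div_le_iff₀ (abs_pos.2 ht), ← norm_neg, neg_sub]
  rw [show -(Complex.I * t * u) = Complex.I * ((-(t * u) : ℝ) : ℂ) by push_cast; ring]
  refine h.trans_eq ?_
  rw [norm_neg, norm_mul, mul_comm]
  rfl

/-- Averaging the integrand over `t` and `-t` leaves `(sin tv - sin t(v-u)) / t`. The value at `t =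
0`, where division by zero returns `0`, is irrelevant to the integral. -/
lemma integral_one_sub_exp_div_mul_exp (T u v : ℝ) :
    ∫ t in (-T)..T, (1 - Complex.exp (-(Complex.I * t * u))) / (Complex.I * t)
      * Complex.exp (Complex.I * t * v) = ((symmSinc (T * v) - symmSinc (T * (v - u)) : ℝ) : ℂ) := by
  set h : ℝ → ℂ := fun t => (1 - Complex.exp (-(Complex.I * t * u))) / (Complex.I * t)
      * Complex.exp (Complex.I * t * v) with hh
  have hint : IntervalIntegrable h volume (-T) T := by
    rw [intervalIntegrable_iff]
    have : IsFiniteMeasure (volume.restrict (Set.uIoc (-T) T)) := ⟨by simp [Set.uIoc]⟩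
    refine Integrable.of_bound (C := |u|) (by
      have : Measurable h := by fun_prop
      exact this.aestronglyMeasurable) (Eventually.of_forall fun t => ?_)
    rw [norm_mul, norm_exp_I_mul, mul_one]
    exact norm_one_sub_exp_div_le t u
  have hneg : ∫ t in (-T)..T, h (-t) = ∫ t in (-T)..T, h t := by
    rw [intervalIntegral.integral_comp_neg, neg_neg]
  have hint' : IntervalIntegrable (fun t => h (-t)) volume (-T) T := by
    simpa [div_neg] using (hint.comp_mul_left (c := -1) (by norm_num)).symm
  have hscale : ∀ w : ℝ, ∫ t in (-T)..T, w * Real.sinc (t * w) = symmSinc (T * w) := by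
    intro w
    rw [intervalIntegral.integral_const_mul, intervalIntegral.mul_integral_comp_mul_right,
      symmSinc, neg_mul]
  have hsinc : ∀ w : ℝ, Continuous fun t => w * Real.sinc (t * w) := fun w =>
    (Real.continuous_sinc.comp (by fun_prop)).const_mul w
  have hsum : ∫ t in (-T)..T, (h t + h (-t))
      = ∫ t in (-T)..T, ((2 * (v * Real.sinc (t * v)
        - (v - u) * Real.sinc (t * (v - u))) : ℝ) : ℂ) := by
    apply intervalIntegral.integral_congr_ae
    filter_upwards [(Measure.ae_ne volume 0)] with t ht _
    have ht' : (t : ℂ) ≠ 0 := by exact_mod_cast ht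
    have hs : ∀ w : ℝ, w * Real.sinc (t * w) = Real.sin (t * w) / t := by
      intro w
      rcases eq_or_ne w 0 with rfl | hw
      · simp
      · rw [Real.sinc_of_ne_zero (mul_ne_zero ht hw)]
        field_simp
    have e : ∀ s : ℝ, Complex.exp (-(Complex.I * s * u)) * Complex.exp (Complex.I * s * v)
        = Complex.exp (Complex.I * s * (v - u)) := by
      intro s; rw [← Complex.exp_add]; ring_nf
    have h1 : ∀ s : ℝ, h s = (Complex.exp (Complex.I * s * v)
        - Complex.exp (Complex.I * s * (v - u))) / (Complex.I * s) := by
      intro s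
      rw [← e, hh]
      ring
    rw [h1, h1, hs, hs]
    push_cast
    rw [Complex.sin, Complex.sin]
    rw [show Complex.I * t * v = t * v * Complex.I by ring,
      show Complex.I * t * (v - u) = t * (v - u) * Complex.I by ring,
      show Complex.I * -t * v = -(t * v) * Complex.I by ring,
      show Complex.I * -t * (v - u) = -(t * (v - u)) * Complex.I by ring]
    field_simp
    rw [Complex.I_sq]
    ring
  rw [intervalIntegral.integral_add hint hint', hneg, ← two_mul] at hsum
  rw [intervalIntegral.integral_ofReal, intervalIntegral.integral_const_mul,
    intervalIntegral.integral_sub ((hsinc _).intervalIntegrable _ _)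
    ((hsinc _).intervalIntegrable _ _), hscale, hscale] at hsum
  push_cast at hsum ⊢
  exact mul_left_cancel₀ two_ne_zero hsum

lemma integral_inversion_eq (γ : ℝ) (M : Measure ℝ) [IsFiniteMeasure M] (T u : ℝ) :
    ∫ t in (-T)..T, (1 - Complex.exp (-(Complex.I * t * u))) / (Complex.I * t)
      * secondDiff (measureExponent γ M) t
      = ((∫ v, (symmSinc (T * v) - symmSinc (T * (v - u))) * weight v ∂M : ℝ) : ℂ) := by
  have : IsFiniteMeasure (volume.restrict (Set.uIoc (-T) T)) := ⟨by simp [Set.uIoc]⟩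
  have hswap : ∫ t in (-T)..T, ∫ v, (1 - Complex.exp (-(Complex.I * t * u))) / (Complex.I * t)
      * (Complex.exp (Complex.I * t * v) * weight v) ∂M
      = ∫ v, (∫ t in (-T)..T, (1 - Complex.exp (-(Complex.I * t * u))) / (Complex.I * t)
      * (Complex.exp (Complex.I * t * v) * weight v)) ∂M := by
    apply intervalIntegral_integral_swap
    refine Integrable.of_bound (C := |u| * 14) ?_ (Eventually.of_forall fun p => ?_)
    · have hw : Measurable weight := continuous_weight.measurable
      have : Measurable (Function.uncurry fun t v : ℝ =>
          (1 - Complex.exp (-(Complex.I * t * u))) / (Complex.I * t)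
          * (Complex.exp (Complex.I * t * v) * weight v)) := by
        unfold Function.uncurry
        fun_prop
      exact this.aestronglyMeasurable
    · simp only [Function.uncurry]
      rw [norm_mul, norm_mul, norm_exp_I_mul, one_mul, Complex.norm_real]
      gcongr
      · exact norm_one_sub_exp_div_le p.1 u
      · exact abs_weight_le p.2
  simp_rw [secondDiff_measureExponent, ← integral_const_mul]
  rw [hswap, ← integral_complex_ofReal]
  congr with v
  simp_rw [← mul_assoc]
  rw [intervalIntegral.integral_mul_const, integral_one_sub_exp_div_mul_exp]
  push_cast
  ring

/-- By Fubini the truncated integral is an integral over `v` of differences of `symmSinc`, which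
converge boundedly to `π (sign v - sign (v - u))`. -/
theorem tendsto_inversion (γ : ℝ) (M : Measure ℝ) [IsFiniteMeasure M] (u : ℝ) :
    Tendsto (fun T : ℝ => (1 / (2 * (Real.pi : ℂ))) * ∫ t in (-T)..T,
          (1 - Complex.exp (-(Complex.I * t * u))) / (Complex.I * t) *
            secondDiff (measureExponent γ M) t) atTop
      (𝓝 ((∫ v, ((Real.sign v - Real.sign (v - u)) / 2) * weight v ∂M : ℝ) : ℂ)) := by
  simp_rw [integral_inversion_eq]
  have hlim : Tendsto (fun T => ∫ v, (symmSinc (T * v) - symmSinc (T * (v - u))) * weight v ∂M)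
      atTop (𝓝 (∫ v, (Real.pi * Real.sign v - Real.pi * Real.sign (v - u)) * weight v ∂M)) := by
    have := continuous_symmSinc
    refine tendsto_integral_filter_of_dominated_convergence (fun _ => (8 + 8) * 14)
      (Eventually.of_forall fun T => Continuous.aestronglyMeasurable (by fun_prop))
      (Eventually.of_forall fun T => Eventually.of_forall fun v => ?_) (integrable_const _)
      (Eventually.of_forall fun v =>
        ((tendsto_symmSinc_mul v).sub (tendsto_symmSinc_mul (v - u))).mul_const _)
    rw [norm_mul]
    gcongr
    · exact (norm_sub_le _ _).trans (add_le_add (abs_symmSinc_le _) (abs_symmSinc_le _))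
    · exact abs_weight_le v
  have h2 := ((Complex.continuous_ofReal.tendsto _).comp hlim).const_mul (1 / (2 * (Real.pi : ℂ)))
  convert! h2 using 2
  have h3 : ∫ v, (Real.pi * Real.sign v - Real.pi * Real.sign (v - u)) * weight v ∂M
      = 2 * Real.pi * ∫ v, ((Real.sign v - Real.sign (v - u)) / 2) * weight v ∂M := by
    rw [← integral_const_mul]
    congr with v
    ring
  have hpi : (Real.pi : ℂ) ≠ 0 := by exact_mod_cast Real.pi_ne_zero
  rw [h3]
  push_cast
  field_simp

/-! ### Recovering the measure from its primitive -/

section SignIntegral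

variable {m m' : Measure ℝ} [IsFiniteMeasure m] [IsFiniteMeasure m']

lemma measurable_sign : Measurable Real.sign := by
  unfold Real.sign
  exact Measurable.ite measurableSet_Iio measurable_const
    (Measurable.ite measurableSet_Ioi measurable_const measurable_const)

lemma abs_sign_le (x : ℝ) : |Real.sign x| ≤ 1 := by
  rcases Real.sign_apply_eq x with h | h | h <;> simp [h]

lemma integrable_sign_sub (u : ℝ) : Integrable (fun v => Real.sign (v - u)) m :=
  Integrable.of_bound (measurable_sign.comp (by fun_prop)).aestronglyMeasurable 1
    (Eventually.of_forall fun _ => abs_sign_le _)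

lemma tendsto_integral_sign_sub {l : Filter ℝ} [l.IsCountablyGenerated] {g : ℝ → ℝ}
    (h : ∀ v, Tendsto (fun u => Real.sign (v - u)) l (𝓝 (g v))) :
    Tendsto (fun u => ∫ v, Real.sign (v - u) ∂m) l (𝓝 (∫ v, g v ∂m)) :=
  tendsto_integral_filter_of_dominated_convergence (fun _ => 1)
    (Eventually.of_forall fun u => (integrable_sign_sub u).1)
    (Eventually.of_forall fun _ => Eventually.of_forall fun _ => abs_sign_le _)
    (integrable_const _) (Eventually.of_forall h)

lemma tendsto_integral_sign_sub_atTop :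
    Tendsto (fun u => ∫ v, Real.sign (v - u) ∂m) atTop (𝓝 (-m.real Set.univ)) := by
  have h := tendsto_integral_sign_sub (m := m) (l := atTop) (g := fun _ => -1) fun v => by
    refine tendsto_const_nhds.congr' ?_
    filter_upwards [eventually_gt_atTop v] with u hu
    rw [Real.sign_of_neg (sub_neg.2 hu)]
  simpa using h

lemma tendsto_integral_sign_sub_atBot :
    Tendsto (fun u => ∫ v, Real.sign (v - u) ∂m) atBot (𝓝 (m.real Set.univ)) := by
  have h := tendsto_integral_sign_sub (m := m) (l := atBot) (g := fun _ => 1) fun v => by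
    refine tendsto_const_nhds.congr' ?_
    filter_upwards [eventually_lt_atBot v] with u hu
    rw [Real.sign_of_pos (sub_pos.2 hu)]
  simpa using h

/-- Approaching `u` from the right moves a possible atom at `u` wholly to the negative side, which
turns half weights into the distribution function. -/
lemma tendsto_integral_sign_sub_nhdsGT (u : ℝ) :
    Tendsto (fun w => ∫ v, Real.sign (v - w) ∂m) (𝓝[>] u)
      (𝓝 (m.real Set.univ - 2 * m.real (Set.Iic u))) := by
  have h := tendsto_integral_sign_sub (m := m) (l := 𝓝[>] u)
    (g := fun v => 1 - 2 * (Set.Iic u).indicator (fun _ => (1 : ℝ)) v) fun v => by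
    refine tendsto_const_nhds.congr' ?_
    rcases le_or_gt v u with hv | hv
    · filter_upwards [self_mem_nhdsWithin] with w hw
      rw [Real.sign_of_neg (sub_neg.2 (hv.trans_lt hw)), Set.indicator_of_mem (Set.mem_Iic.2 hv)]
      norm_num
    · filter_upwards [Ioo_mem_nhdsGT hv] with w hw
      rw [Real.sign_of_pos (sub_pos.2 hw.2), Set.indicator_of_notMem (by simpa using hv)]
      norm_num
  rw [integral_sub (integrable_const _)
    (((integrable_const _).indicator measurableSet_Iic).const_mul _), integral_const_mul,
    integral_indicator_const _ measurableSet_Iic] at h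
  simpa using h

/-- The constant allows for the normalisation of the primitive at `0`. The limits at `+∞` and `-∞`
contain the masses with opposite signs, so together they force `c = 0` and equal total masses. -/
lemma eq_of_integral_sign_sub_eq_add (c : ℝ)
    (h : ∀ u, ∫ v, Real.sign (v - u) ∂m = (∫ v, Real.sign (v - u) ∂m') + c) : m = m' := by
  have h1 : -m.real Set.univ = -m'.real Set.univ + c :=
    tendsto_nhds_unique tendsto_integral_sign_sub_atTop
      ((tendsto_integral_sign_sub_atTop.add_const c).congr fun u => (h u).symm)
  have h2 : m.real Set.univ = m'.real Set.univ + c :=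
    tendsto_nhds_unique tendsto_integral_sign_sub_atBot
      ((tendsto_integral_sign_sub_atBot.add_const c).congr fun u => (h u).symm)
  refine Measure.ext_of_Iic _ _ fun u => ?_
  have h3 := tendsto_nhds_unique (tendsto_integral_sign_sub_nhdsGT u)
    (((tendsto_integral_sign_sub_nhdsGT u).add_const c).congr fun u => (h u).symm)
  rw [← measureReal_eq_measureReal_iff]
  linarith

end SignIntegral

/-- The function `primitive` in terms of the Lebesgue–Stieltjes measure. -/
noncomputable def measurePrimitive (M : Measure ℝ) (u : ℝ) : ℝ :=
  ∫ v, ((Real.sign v - Real.sign (v - u)) / 2) * weight v ∂M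

lemma measurePrimitive_eq (M : Measure ℝ) [IsFiniteMeasure M] (u : ℝ) :
    measurePrimitive M u = ((∫ v, Real.sign (v - u) ∂(weightedMeasure M))
      - ∫ v, Real.sign (v - 0) ∂(weightedMeasure M)) / 2 := by
  rw [← integral_sub (integrable_sign_sub u) (integrable_sign_sub 0), ← integral_div,
    integral_weightedMeasure, measurePrimitive]
  congr with v
  rw [smul_eq_mul, sub_zero]
  ring

lemma measurePrimitive_injective {M N : Measure ℝ} [IsFiniteMeasure M] [IsFiniteMeasure N]
    (h : ∀ u, measurePrimitive M u = measurePrimitive N u) : M = N := by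
  apply weightedMeasure_injective
  refine eq_of_integral_sign_sub_eq_add ((∫ v, Real.sign (v - 0) ∂(weightedMeasure M))
      - ∫ v, Real.sign (v - 0) ∂(weightedMeasure N)) fun u => ?_
  have := h u
  rw [measurePrimitive_eq, measurePrimitive_eq] at this
  linarith

/-! ### Stieltjes functions and finite measures -/

lemma abs_rightLim_le {G : ℝ → ℝ} (hG : Monotone G) {C : ℝ} (hC : ∀ u, |G u| ≤ C) (u : ℝ) :
    |hG.stieltjesFunction u| ≤ C :=
  (isClosed_le continuous_abs continuous_const).mem_of_tendsto (hG.tendsto_rightLim u)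
    (Eventually.of_forall hC)

lemma isFiniteMeasure_stieltjes {G : ℝ → ℝ} (hG : Monotone G) (hb : ∃ C : ℝ, ∀ u, |G u| ≤ C) :
    IsFiniteMeasure hG.stieltjesFunction.measure := by
  obtain ⟨C, hC⟩ := hb
  exact StieltjesFunction.isFiniteMeasure_of_forall_abs_le _ (abs_rightLim_le hG hC)

lemma stieltjesFunction_eq_of_continuousAt {G : ℝ → ℝ} (hG : Monotone G) {u : ℝ}
    (hu : ContinuousAt G u) : hG.stieltjesFunction u = G u := by
  rw [hG.stieltjesFunction_eq]
  exact tendsto_nhds_unique (hG.tendsto_rightLim u) (hu.tendsto.mono_left nhdsWithin_le_nhds)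

lemma stieltjesFunction_mono_eq (f : StieltjesFunction ℝ) : f.mono.stieltjesFunction = f := by
  ext u
  rw [f.mono.stieltjesFunction_eq, f.rightLim_eq]

/-- The right-continuous modifications differ by a constant, and each agrees with its original
function at continuity points. -/
lemma eqUpToConst_of_measure_eq {G H : ℝ → ℝ} (hG : Monotone G) (hH : Monotone H)
    (h : hG.stieltjesFunction.measure = hH.stieltjesFunction.measure) : EqUpToConst G H := by
  set c := hG.stieltjesFunction 0 - hH.stieltjesFunction 0
  have h1 : hG.stieltjesFunction = hH.stieltjesFunction + StieltjesFunction.const ℝ c := by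
    refine StieltjesFunction.eq_of_measure_of_eq _ _ (y := 0) ?_ ?_
    · rw [StieltjesFunction.measure_add, StieltjesFunction.measure_const, add_zero, h]
    · simp [c]
  refine ⟨c, fun u hGu hHu => ?_⟩
  rw [← stieltjesFunction_eq_of_continuousAt hG hGu, ← stieltjesFunction_eq_of_continuousAt hH hHu,
    h1]
  simp

/-- Takes the total mass times the distribution function of the normalised measure. -/
lemma exists_stieltjesFunction_measure_eq (M : Measure ℝ) [IsFiniteMeasure M] :
    ∃ G : StieltjesFunction ℝ, Tendsto G atBot (𝓝 0) ∧ (∃ C : ℝ, ∀ u, |G u| ≤ C) ∧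
      G.measure = M := by
  obtain ⟨p, hp⟩ := exists_eq_smul_isProbabilityMeasure M
  set r := (M Set.univ).toNNReal
  refine ⟨r • ProbabilityTheory.cdf (p : Measure ℝ), ?_, ⟨r, fun u => ?_⟩, ?_⟩
  · have := (ProbabilityTheory.tendsto_cdf_atBot (p : Measure ℝ)).const_mul (r : ℝ)
    rw [mul_zero] at this
    exact this
  · change |(r : ℝ) * ProbabilityTheory.cdf (p : Measure ℝ) u| ≤ r
    rw [abs_mul, abs_of_nonneg r.coe_nonneg,
      abs_of_nonneg (ProbabilityTheory.cdf_nonneg _ _)]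
    exact mul_le_of_le_one_right r.2 (ProbabilityTheory.cdf_le_one _ _)
  · rw [StieltjesFunction.measure_smul, ProbabilityTheory.measure_cdf, ← hp]

/-! ### The canonical representation -/

lemma IsRepresentation.isFiniteMeasure {φ : ℝ → ℂ} {γ : ℝ} {G : ℝ → ℝ}
    (h : IsRepresentation φ γ G) : IsFiniteMeasure h.monotone.stieltjesFunction.measure :=
  isFiniteMeasure_stieltjes h.monotone h.bounded

lemma IsRepresentation.isContinuousLog {φ : ℝ → ℂ} {γ : ℝ} {G : ℝ → ℝ}
    (h : IsRepresentation φ γ G) :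
    IsContinuousLog φ (measureExponent γ h.monotone.stieltjesFunction.measure) := by
  obtain ⟨ψ, hψ, heq⟩ := h.log_eq
  have : ψ = measureExponent γ h.monotone.stieltjesFunction.measure := funext heq
  exact this ▸ hψ

lemma isRepresentation_of_isContinuousLog {φ : ℝ → ℂ} {γ : ℝ} {M : Measure ℝ}
    (h : IsContinuousLog φ (measureExponent γ M)) {G : StieltjesFunction ℝ}
    (hG : ∃ C : ℝ, ∀ u, |G u| ≤ C) (hGM : G.measure = M) : IsRepresentation φ γ G := by
  refine ⟨G.mono, hG, measureExponent γ M, h, fun t => ?_⟩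
  rw [exponent, stieltjesFunction_mono_eq, hGM, measureExponent]

lemma IsRepresentation.unique {φ : ℝ → ℂ} {γ γ' : ℝ} {G G' : ℝ → ℝ}
    (h : IsRepresentation φ γ G) (h' : IsRepresentation φ γ' G') :
    γ = γ' ∧ h.monotone.stieltjesFunction.measure = h'.monotone.stieltjesFunction.measure := by
  have := h.isFiniteMeasure
  have := h'.isFiniteMeasure
  exact measureExponent_injective (h.isContinuousLog.unique h'.isContinuousLog)

lemma IsInfinitelyDivisibleCharFun.exists_isRepresentation {φ : ℝ → ℂ}
    (h : IsInfinitelyDivisibleCharFun φ) : ∃ (γ : ℝ) (G : StieltjesFunction ℝ),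
      Tendsto G atBot (𝓝 0) ∧ IsRepresentation φ γ G := by
  obtain ⟨γ, M, hM, hφ⟩ := (isInfinitelyDivisibleCharFun_iff φ).1 h
  obtain ⟨G, hG0, hGb, hGM⟩ := exists_stieltjesFunction_measure_eq M
  exact ⟨γ, G, hG0, isRepresentation_of_isContinuousLog hφ hGb hGM⟩

end LevyKhintchine

open LevyKhintchine in
theorem mainTheorem1 (φ : ℝ → ℂ) :
    -- the representation
    (LevyKhintchine.IsInfinitelyDivisibleCharFun φ ↔
      ∃ (γ : ℝ) (G : ℝ → ℝ), LevyKhintchine.IsRepresentation φ γ G) ∧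
    -- existence and uniqueness with `G` right-continuous and `G(-∞) = 0`
    (LevyKhintchine.IsInfinitelyDivisibleCharFun φ →
      ∃! p : ℝ × StieltjesFunction ℝ,
        Tendsto p.2 atBot (𝓝 0) ∧ LevyKhintchine.IsRepresentation φ p.1 p.2) ∧
    -- uniqueness without normalization of `G`
    (∀ (γ γ' : ℝ) (G G' : ℝ → ℝ), LevyKhintchine.IsRepresentation φ γ G →
      LevyKhintchine.IsRepresentation φ γ' G' →
      γ = γ' ∧ LevyKhintchine.EqUpToConst G G') ∧
    -- the inversion formula, which recovers `K` from `log φ`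
    (∀ (γ : ℝ) (G : ℝ → ℝ) (h : LevyKhintchine.IsRepresentation φ γ G) (ψ : ℝ → ℂ),
      LevyKhintchine.IsContinuousLog φ ψ → ∀ u : ℝ,
      Tendsto (fun T : ℝ => (1 / (2 * (Real.pi : ℂ))) * ∫ t in (-T)..T,
          (1 - Complex.exp (-(Complex.I * t * u))) / (Complex.I * t) *
            LevyKhintchine.secondDiff ψ t)
        atTop (𝓝 ((LevyKhintchine.primitive h.monotone u : ℝ) : ℂ))) ∧
    -- `K` determines `G`
    (∀ (G H : ℝ → ℝ) (hG : Monotone G) (hH : Monotone H),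
      (∃ C : ℝ, ∀ u, |G u| ≤ C) → (∃ C : ℝ, ∀ u, |H u| ≤ C) →
      (∀ u, LevyKhintchine.primitive hG u = LevyKhintchine.primitive hH u) →
      LevyKhintchine.EqUpToConst G H) := by
  refine ⟨⟨fun h => ?_, ?_⟩, fun h => ?_, ?_, ?_, ?_⟩
  · obtain ⟨γ, G, -, hG⟩ := h.exists_isRepresentation
    exact ⟨γ, G, hG⟩
  · rintro ⟨γ, G, h⟩
    exact (isInfinitelyDivisibleCharFun_iff φ).2
      ⟨γ, _, h.isFiniteMeasure, h.isContinuousLog⟩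
  · obtain ⟨γ, G, hG0, hG⟩ := h.exists_isRepresentation
    refine ⟨(γ, G), ⟨hG0, hG⟩, ?_⟩
    rintro ⟨γ', G'⟩ ⟨hG0', hG'⟩
    obtain ⟨h1, h2⟩ := hG'.unique hG
    rw [stieltjesFunction_mono_eq, stieltjesFunction_mono_eq] at h2
    exact Prod.ext h1 (G'.eq_of_measure_of_tendsto_atBot G h2 hG0' hG0)
  · intro γ γ' G G' h h'
    exact ⟨(h.unique h').1, eqUpToConst_of_measure_eq _ _ (h.unique h').2⟩
  · intro γ G h ψ hψ u
    have := h.isFiniteMeasure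
    rw [hψ.unique h.isContinuousLog]
    exact tendsto_inversion γ _ u
  · intro G H hG hH hGb hHb h
    have := isFiniteMeasure_stieltjes hG hGb
    have := isFiniteMeasure_stieltjes hH hHb
    exact eqUpToConst_of_measure_eq hG hH (measurePrimitive_injective h)
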